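/- Let $H_0$ denote the Moser spindle, that is, the graph on vertices $v_0,\dots,v_6$ consisting of the 7-cycle $v_0v_1v_2v_3v_4v_5v_6$ together with the four chords $v_0v_2$, $v_0v_5$, $v_1v_3$ and $v_4v_6$. A graph is called locally bipartite if the neighbourhood of every vertex induces a bipartite graph. Let $G$ be a finite simple graph that is locally bipartite. If its minimum degree satisfies $\delta(G) > \frac{6}{11}\,|G|$, where $|G|$ is the number of vertices of $G$, then $G$ is 3-colourable or contains $H_0$ as a (not necessarily induced) subgraph. -/

import Mathlib

/-- A graph is locally bipartite if the subgraph induced by the neighbourhood of each vertex is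
bipartite (i.e. 2-colourable). -/
def LocallyBipartite {V : Type*} (G : SimpleGraph V) : Prop :=
  ∀ v : V, (G.induce (G.neighborSet v)).IsBipartite

/-- The graph `H₀`, i.e. the Moser spindle: the 7-cycle `0 1 2 3 4 5 6` together with the four
chords `05`, `02`, `13`, `46`. -/
def moserSpindle : SimpleGraph (Fin 7) :=
  SimpleGraph.fromEdgeSet
    {s(0, 1), s(1, 2), s(2, 3), s(3, 4), s(4, 5), s(5, 6), s(6, 0),
      s(0, 5), s(0, 2), s(1, 3), s(4, 6)}

/-! Pass to an edge-maximal locally bipartite spindle-free supergraph on the same vertices; the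
degree bound survives, so it suffices to 3-colour this graph. It turns out to be complete
multipartite, and since local bipartiteness excludes `K₄`, it has at most three parts.

The central notion is the dense pair: two vertices that are the ends of a diamond. A Moser spindle
is a chain of two dense pairs whose ends are adjacent, so its absence says that chains of length two
never close up. The degree bound lifts this to chains of length three and four
(`noClosedChain_three`, `noClosedChain_four`).

If `u` and `v` are distinct and non-adjacent, maximality says that adding `uv` destroys local
bipartiteness or creates a spindle. A spindle lacking the edge `uv` yields a 2-chain from `u` to
`v`; otherwise an even geodesic joins them inside some neighbourhood, and every second vertex of it
gives a dense pair. Such geodesics have length at most eight, and together with the absence of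
closed chains this makes dense pairs twins (`IsDense.adj_of_adj`). Hence non-adjacent vertices
always have the same neighbours.

All quantitative steps use one averaging argument: for any nonzero weights on a configuration, some
vertex misses less than 5/11 of the weight. A finite check shows that the neighbours of that vertex
in the configuration force a closed chain, an odd closed walk in a neighbourhood, or another
excluded adjacency, or else one of a few listed extensions. -/

/-! ### Dense pairs and chains -/

/-- Two vertices are dense if their common neighbourhood contains an edge. -/
def IsDense {V : Type*} (G : SimpleGraph V) (u v : V) : Prop :=
  ∃ p q, G.Adj p q ∧ G.Adj u p ∧ G.Adj u q ∧ G.Adj v p ∧ G.Adj v q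

/-- `DenseChain G k u v`: there are `u = w₀, w₁, …, wₖ = v` with consecutive vertices dense. -/
def DenseChain {V : Type*} (G : SimpleGraph V) : ℕ → V → V → Prop
  | 0, u, v => u = v
  | k + 1, u, v => ∃ w, IsDense G u w ∧ DenseChain G k w v

/-- The ends of a chain of `k` dense pairs are never adjacent. -/
def NoClosedChain {V : Type*} (G : SimpleGraph V) (k : ℕ) : Prop :=
  ∀ u v, DenseChain G k u v → ¬ G.Adj u v

open Classical in
/-- Every degree exceeds `6/11` of the number of vertices. -/
def LargeDegree {V : Type*} [Fintype V] (G : SimpleGraph V) : Prop :=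
  ∀ v, 6 * Fintype.card V < 11 * (Finset.univ.filter (G.Adj v)).card

theorem IsDense.symm {V : Type*} {G : SimpleGraph V} {u v : V} (h : IsDense G u v) :
    IsDense G v u := by
  obtain ⟨p, q, h1, h2, h3, h4, h5⟩ := h
  exact ⟨p, q, h1, h4, h5, h2, h3⟩

theorem DenseChain.trans {V : Type*} {G : SimpleGraph V} {j k : ℕ} {u v w : V}
    (h₁ : DenseChain G j u v) (h₂ : DenseChain G k v w) : DenseChain G (k + j) u w := by
  induction j generalizing u with
  | zero => cases h₁; exact h₂
  | succ j ih =>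
    obtain ⟨z, hz, hc⟩ := h₁
    exact ⟨z, hz, ih hc⟩

theorem IsDense.chain {V : Type*} {G : SimpleGraph V} {u v : V} (h : IsDense G u v) :
    DenseChain G 1 u v := ⟨v, h, rfl⟩

theorem DenseChain.symm {V : Type*} {G : SimpleGraph V} {k : ℕ} {u v : V}
    (h : DenseChain G k u v) : DenseChain G k v u := by
  induction k generalizing u with
  | zero => exact Eq.symm h
  | succ k ih =>
    obtain ⟨z, hz, hc⟩ := h
    have := (ih hc).trans hz.symm.chain
    rwa [add_comm] at this

/-- Any two vertices have a common neighbour. -/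
theorem LargeDegree.exists_common {V : Type*} [Fintype V] {G : SimpleGraph V}
    (hd : LargeDegree G) (u v : V) : ∃ w, G.Adj u w ∧ G.Adj v w := by
  classical
  by_contra hcon
  push Not at hcon
  have hdis : Disjoint (Finset.univ.filter (G.Adj u)) (Finset.univ.filter (G.Adj v)) := by
    rw [Finset.disjoint_left]
    intro w h1 h2
    simp only [Finset.mem_filter, Finset.mem_univ, true_and] at h1 h2
    exact hcon w h1 h2
  have h := Finset.card_le_univ
    (Finset.univ.filter (G.Adj u) ∪ Finset.univ.filter (G.Adj v))
  rw [Finset.card_union_of_disjoint hdis] at h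
  have h1 := hd u
  have h2 := hd v
  convert_to 6 * Fintype.card V < 11 * (Finset.univ.filter (G.Adj u)).card at h1
  convert_to 6 * Fintype.card V < 11 * (Finset.univ.filter (G.Adj v)).card at h2
  omega

/-- Every vertex has a neighbour and every edge lies in a triangle. Reflexivity lets chains be
padded, so only upper bounds on their length matter. -/
theorem LargeDegree.isDense_self {V : Type*} [Fintype V] {G : SimpleGraph V}
    (hd : LargeDegree G) (u : V) : IsDense G u u := by
  obtain ⟨v, hv, -⟩ := hd.exists_common u u
  obtain ⟨w, hw, hw'⟩ := hd.exists_common u v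
  exact ⟨v, w, hw', hv, hw, hv, hw⟩

theorem LargeDegree.chain_mono {V : Type*} [Fintype V] {G : SimpleGraph V}
    (hd : LargeDegree G) {j k : ℕ} (hjk : j ≤ k) {u v : V} (h : DenseChain G j u v) :
    DenseChain G k u v := by
  induction hjk with
  | refl => exact h
  | step _ ih => exact ⟨u, hd.isDense_self u, ih⟩

/-! ### Weighted counting and local colourings -/

/-- Weighted double counting: some vertex misses less than `5/11` of the total weight. -/
theorem LargeDegree.exists_heavy {V : Type*} [Fintype V] {G : SimpleGraph V}
    (hd : LargeDegree G) {ι : Type*} (s : Finset ι) (f : ι → V) (w : ι → ℕ)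
    (hw : 0 < ∑ i ∈ s, w i) :
    ∃ x, ∀ t : Finset ι, t ⊆ s → (∀ i ∈ t, ¬ G.Adj x (f i)) →
      11 * ∑ i ∈ t, w i < 5 * ∑ i ∈ s, w i := by
  classical
  by_contra hcon
  push Not at hcon
  -- Under the negation every vertex sees at most 6/11 of the weight; summing over all vertices
  -- contradicts the degree bound.
  have key : ∀ x, 11 * ∑ i ∈ s, (if G.Adj x (f i) then w i else 0) ≤ 6 * ∑ i ∈ s, w i := by
    intro x
    obtain ⟨t, ht, hadj, hle⟩ := hcon x
    have h1 : ∑ i ∈ t, w i + ∑ i ∈ s, (if G.Adj x (f i) then w i else 0) ≤ ∑ i ∈ s, w i := by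
      rw [← Finset.sum_sdiff ht, add_comm, ← Finset.sum_sdiff ht (f := w)]
      have h0 : ∑ i ∈ t, (if G.Adj x (f i) then w i else 0) = 0 :=
        Finset.sum_eq_zero fun i hi => if_neg (hadj i hi)
      have h2 : ∑ i ∈ s \ t, (if G.Adj x (f i) then w i else 0) ≤ ∑ i ∈ s \ t, w i :=
        Finset.sum_le_sum fun i _ => by split_ifs <;> omega
      omega
    omega
  have h2 : ∑ x : V, ∑ i ∈ s, (if G.Adj x (f i) then w i else 0)
      = ∑ i ∈ s, w i * (Finset.univ.filter (G.Adj (f i))).card := by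
    rw [Finset.sum_comm]
    refine Finset.sum_congr rfl fun i _ => ?_
    rw [← Finset.sum_filter, Finset.sum_const, smul_eq_mul, mul_comm]
    simp only [G.adj_comm]
  have h3 : 11 * ∑ x : V, ∑ i ∈ s, (if G.Adj x (f i) then w i else 0)
      ≤ Fintype.card V * (6 * ∑ i ∈ s, w i) := by
    rw [Finset.mul_sum]
    calc _ ≤ ∑ _x : V, 6 * ∑ i ∈ s, w i := Finset.sum_le_sum fun x _ => key x
      _ = _ := by simp
  have h4 : ∑ i ∈ s, w i * (6 * Fintype.card V)
      < ∑ i ∈ s, w i * (11 * (Finset.univ.filter (G.Adj (f i))).card) := by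
    obtain ⟨i, hi, hpos⟩ : ∃ i ∈ s, 0 < w i := by
      by_contra hno
      push Not at hno
      exact absurd (Finset.sum_eq_zero fun i hi => Nat.le_zero.1 (hno i hi)) hw.ne'
    have hdv : ∀ v, 6 * Fintype.card V < 11 * (Finset.univ.filter (G.Adj v)).card := by
      intro v; convert hd v
    exact Finset.sum_lt_sum (fun i _ => Nat.mul_le_mul_left _ (hdv _).le)
      ⟨i, hi, Nat.mul_lt_mul_of_pos_left (hdv _) hpos⟩
  rw [h2, Finset.mul_sum] at h3
  rw [← Finset.sum_mul] at h4
  have h5 : ∑ i ∈ s, w i * (11 * (Finset.univ.filter (G.Adj (f i))).card)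
      = ∑ i ∈ s, 11 * (w i * (Finset.univ.filter (G.Adj (f i))).card) :=
    Finset.sum_congr rfl fun i _ => by ring
  rw [h5] at h4
  nlinarith [h3, h4]

/-- Values of `χ` outside the neighbourhood of `x` are irrelevant; a total function avoids subtypes.
-/
theorem LocallyBipartite.exists_bool_coloring {V : Type*} {G : SimpleGraph V}
    (hG : LocallyBipartite G) (x : V) :
    ∃ χ : V → Bool, ∀ u v, G.Adj x u → G.Adj x v → G.Adj u v → χ u ≠ χ v := by
  classical
  obtain ⟨C⟩ := hG x
  refine ⟨fun u => if h : G.Adj x u then decide (C ⟨u, h⟩ = 0) else true, ?_⟩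
  intro u v hu hv huv
  have hne : C ⟨u, hu⟩ ≠ C ⟨v, hv⟩ := C.valid (by simpa using huv)
  simp only [hu, hv, dif_pos]
  intro h
  apply hne
  rw [decide_eq_decide] at h
  generalize C ⟨u, hu⟩ = a at *
  generalize C ⟨v, hv⟩ = b at *
  omega

/-! ### Finite patterns

A pattern on the vertices `0, …, n - 1` is a list `A` of `n` bit masks, the rows of its adjacency
matrix. -/

/-- The rows `r` describe adjacencies that hold between the vertices `f i`. -/
def Realizes {V : Type*} (G : SimpleGraph V) (f : ℕ → V) (r : ℕ → ℕ) : Prop :=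
  ∀ i j, (r i).testBit j = true → G.Adj (f i) (f j)

/-- The rows of the pattern `A` extended by a new last vertex with neighbourhood `m`. -/
def extRow (A : List ℕ) (m i : ℕ) : ℕ :=
  bif i == A.length then m else A.getD i 0 ||| bif m.testBit i then 2 ^ A.length else 0

/-- The common neighbourhood of `i` and `j` contains an edge. -/
def denseAt (r : ℕ → ℕ) (n i j : ℕ) : Bool :=
  (List.range n).any fun p => (r i &&& r j).testBit p && (r p &&& (r i &&& r j)) != 0

def denseAlong (r : ℕ → ℕ) (n : ℕ) : ℕ → List ℕ → Bool
  | _, [] => true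
  | a, b :: l => denseAt r n a b && denseAlong r n b l

def adjAlong (A : List ℕ) : ℕ → List ℕ → Bool
  | _, [] => true
  | a, b :: l => (A.getD a 0).testBit b && adjAlong A b l

/-- A new vertex with neighbourhood `c.1` creates a chain of dense pairs, from `c.2.1` through
`c.2.2`, whose ends are adjacent or constitute a pair in `far`. -/
def chainRefutes (A : List ℕ) (far : List (ℕ × ℕ)) (k : ℕ) (c : ℕ × ℕ × List ℕ) : Bool :=
  Nat.blt c.1 (2 ^ A.length) && denseAlong (extRow A c.1) (A.length + 1) c.2.1 c.2.2 &&
    ((Nat.ble c.2.2.length k && (extRow A c.1 c.2.1).testBit (c.2.2.getLastD c.2.1)) ||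
      (Nat.ble c.2.2.length 2 && far.contains (c.2.1, c.2.2.getLastD c.2.1)))

/-- The neighbourhood `c.1` contains an odd closed walk, from `c.2.1` through `c.2.2`. -/
def walkRefutes (A : List ℕ) (c : ℕ × ℕ × List ℕ) : Bool :=
  adjAlong A c.2.1 c.2.2 && (A.getD (c.2.2.getLastD c.2.1) 0).testBit c.2.1 &&
    c.1.testBit c.2.1 && c.2.2.all (fun i => c.1.testBit i) && c.2.2.length % 2 == 0

/-- Every set of vertices from `i` on whose complement has weight at most `s` contains, together
with the set `T`, one of the sets for which `hit` is true. -/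
def covers (hit : ℕ → Bool) : List ℕ → ℕ → ℕ → ℕ → Bool
  | [], _, T, _ => hit T
  | w :: ws, i, T, s => hit T ||
      (covers hit ws (i + 1) (T ||| 2 ^ i) s && (Nat.blt s w || covers hit ws (i + 1) T (s - w)))

/-- With the weights `ws`, every heavy neighbourhood of a new vertex of the pattern `A` contains
one of the sets in `branches`, or one of the sets excluded by `ext`, `chains` or `walks`. -/
def certifies (A : List ℕ) (far : List (ℕ × ℕ)) (k : ℕ) (ext : List ℕ)
    (chains walks : List (ℕ × ℕ × List ℕ)) (branches ws : List ℕ) : Bool :=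
  A.all (fun a => Nat.blt a (2 ^ A.length)) && chains.all (chainRefutes A far k) &&
    walks.all (walkRefutes A) && Nat.blt 0 ws.sum &&
    covers (fun T => branches.any (fun m => m &&& T == m) || ext.any (fun m => m &&& T == m) ||
      chains.any (fun c => c.1 &&& T == c.1) || walks.any (fun c => c.1 &&& T == c.1))
      ws 0 0 ((5 * ws.sum - 1) / 11)

/-! ### Soundness of the certificates -/

section Soundness

variable {V : Type*} {G : SimpleGraph V} {f : ℕ → V}

/-- The bounds on the rows keep old bits away from the index `A.length`, whose vertex is overwritten
by `x`. -/
theorem realizes_extRow {A : List ℕ} (hA : Realizes G f fun i => A.getD i 0)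
    (hlt : ∀ a ∈ A, a < 2 ^ A.length) {m : ℕ} (hm : m < 2 ^ A.length) {x : V}
    (hx : ∀ i, m.testBit i = true → G.Adj x (f i)) :
    Realizes G (Function.update f A.length x) (extRow A m) := by
  have hbit : ∀ a, a < 2 ^ A.length → ∀ j, a.testBit j = true → j < A.length := by
    intro a ha j hj
    by_contra hcon
    have := Nat.testBit_lt_two_pow (lt_of_lt_of_le ha (Nat.pow_le_pow_right two_pos (not_lt.1 hcon)))
    simp [this] at hj
  have hrow : ∀ i, A.getD i 0 < 2 ^ A.length := by
    intro i
    rcases lt_or_ge i A.length with h | h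
    · rw [List.getD_eq_getElem _ _ h]
      exact hlt _ (List.getElem_mem h)
    · rw [List.getD_eq_default _ _ h]
      positivity
  intro i j hij
  unfold extRow at hij
  by_cases hi : i = A.length
  · subst hi
    simp only [beq_self_eq_true, cond_true] at hij
    have hj := hbit m hm j hij
    rw [Function.update_self, Function.update_of_ne hj.ne]
    exact hx j hij
  · have hi' : (i == A.length) = false := by simpa using hi
    rw [hi', cond_false, Nat.testBit_or, Bool.or_eq_true] at hij
    rw [Function.update_of_ne hi]
    rcases hij with h | h
    · have hj := hbit _ (hrow i) j h
      rw [Function.update_of_ne hj.ne]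
      exact hA i j h
    · cases hmi : m.testBit i
      · simp [hmi] at h
      · rw [hmi, cond_true, Nat.testBit_two_pow] at h
        have hj : j = A.length := by simpa [eq_comm] using h
        subst hj
        rw [Function.update_self]
        exact (hx i hmi).symm

theorem isDense_of_denseAt {r : ℕ → ℕ} (hr : Realizes G f r) {n i j : ℕ}
    (h : denseAt r n i j = true) : IsDense G (f i) (f j) := by
  obtain ⟨p, -, hp⟩ := List.any_eq_true.1 h
  rw [Bool.and_eq_true] at hp
  obtain ⟨hp, hq⟩ := hp
  obtain ⟨q, hq⟩ := Nat.exists_testBit_of_ne_zero (by simpa using hq)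
  rw [Nat.testBit_and, Bool.and_eq_true] at hp hq
  rw [Nat.testBit_and, Bool.and_eq_true] at hq
  exact ⟨f p, f q, hr _ _ hq.1, hr _ _ hp.1, hr _ _ hq.2.1, hr _ _ hp.2, hr _ _ hq.2.2⟩

theorem chain_of_denseAlong {r : ℕ → ℕ} (hr : Realizes G f r) {n : ℕ} (l : List ℕ) (a : ℕ)
    (h : denseAlong r n a l = true) : DenseChain G l.length (f a) (f (l.getLastD a)) := by
  induction l generalizing a with
  | nil => rfl
  | cons b l ih =>
    rw [denseAlong, Bool.and_eq_true] at h
    rw [List.getLastD_cons]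
    exact ⟨f b, isDense_of_denseAt hr h.1, ih b h.2⟩

/-- A chain found in the extended pattern is a chain in `G`. Padded to length `k` it contradicts
`hk`, or padded to length two it contradicts `hfar`. -/
theorem not_adj_of_chainRefutes [Fintype V] (hd : LargeDegree G) {k : ℕ}
    (hk : NoClosedChain G k) {A : List ℕ} (hA : Realizes G f fun i => A.getD i 0)
    (hlt : ∀ a ∈ A, a < 2 ^ A.length) {far : List (ℕ × ℕ)}
    (hfar : ∀ p ∈ far, p.1 < A.length ∧ p.2 < A.length ∧ ¬ DenseChain G 2 (f p.1) (f p.2))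
    {c : ℕ × ℕ × List ℕ} (hc : chainRefutes A far k c = true) (x : V) :
    ¬ ∀ i, c.1.testBit i = true → G.Adj x (f i) := by
  intro hx
  simp only [chainRefutes, Bool.and_eq_true, Bool.or_eq_true] at hc
  obtain ⟨⟨hm, hch⟩, hend⟩ := hc
  have hr := realizes_extRow hA hlt (Nat.blt_eq.mp hm) hx
  have hD := chain_of_denseAlong hr _ _ hch
  rcases hend with ⟨hlen, hadj⟩ | ⟨hlen, hmem⟩
  · exact hk _ _ (hd.chain_mono (Nat.ble_eq.mp hlen) hD) (hr _ _ hadj)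
  · have hmem := hfar _ (List.contains_iff_mem.1 hmem)
    apply hmem.2.2
    rw [Function.update_of_ne hmem.1.ne, Function.update_of_ne hmem.2.1.ne] at hD
    exact hd.chain_mono (Nat.ble_eq.mp hlen) hD

/-- Colours alternate along a walk that stays inside the neighbourhood of `x`. -/
theorem color_getLastD {A : List ℕ} (hA : Realizes G f fun i => A.getD i 0) {x : V}
    {χ : V → Bool} (hχ : ∀ u v, G.Adj x u → G.Adj x v → G.Adj u v → χ u ≠ χ v) (l : List ℕ)
    (a : ℕ) (hl : adjAlong A a l = true) (ha : G.Adj x (f a)) (hx : ∀ i ∈ l, G.Adj x (f i)) :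
    χ (f (l.getLastD a)) = (χ (f a) ^^ (l.length % 2 == 1)) := by
  induction l generalizing a with
  | nil => simp
  | cons b l ih =>
    rw [adjAlong, Bool.and_eq_true] at hl
    have hb := hx b (List.mem_cons_self ..)
    rw [List.getLastD_cons, ih b hl.2 hb fun i hi => hx i (List.mem_cons_of_mem _ hi)]
    have hne := hχ _ _ ha hb (hA _ _ hl.1)
    have : (l.length + 1) % 2 = 1 - l.length % 2 := by omega
    rw [List.length_cons, this]
    rcases Nat.mod_two_eq_zero_or_one l.length with h | h <;> rw [h] <;>
      cases h1 : χ (f a) <;> cases h2 : χ (f b) <;> simp_all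

theorem not_adj_of_walkRefutes (hG : LocallyBipartite G) {A : List ℕ}
    (hA : Realizes G f fun i => A.getD i 0) {c : ℕ × ℕ × List ℕ}
    (hc : walkRefutes A c = true) (x : V) : ¬ ∀ i, c.1.testBit i = true → G.Adj x (f i) := by
  intro hx
  simp only [walkRefutes, Bool.and_eq_true, List.all_eq_true, beq_iff_eq] at hc
  obtain ⟨⟨⟨⟨hal, hlast⟩, ha⟩, hl⟩, hlen⟩ := hc
  obtain ⟨χ, hχ⟩ := hG.exists_bool_coloring x
  have h := color_getLastD hA hχ c.2.2 c.2.1 hal (hx _ ha) fun i hi => hx i (hl i hi)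
  have hmem : G.Adj x (f (c.2.2.getLastD c.2.1)) := by
    rw [List.getLastD_eq_getLast?]
    cases hgl : c.2.2.getLast? with
    | none => exact hx _ ha
    | some b => exact hx _ (hl b (List.mem_of_getLast? hgl))
  refine hχ _ _ hmem (hx _ ha) (hA _ _ hlast) ?_
  rw [h, hlen]
  simp

/-- `covers` explores a decision tree: putting `i` into `T` is free, leaving it out costs its
weight. The branch dictated by `S` stays within the budget, so it reaches a node whose `T` is a hit
and lies inside `S`. -/
theorem exists_hit_of_covers {hit : ℕ → Bool} {S : ℕ → Prop} (ws : List ℕ) (i T s : ℕ)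
    (h : covers hit ws i T s = true) (hT : ∀ j, T.testBit j = true → S j)
    (hs : ∀ t : Finset ℕ, t ⊆ Finset.range ws.length → (∀ j ∈ t, ¬ S (i + j)) →
      ∑ j ∈ t, ws.getD j 0 ≤ s) :
    ∃ T', hit T' = true ∧ ∀ j, T'.testBit j = true → S j := by
  induction ws generalizing i T s with
  | nil => exact ⟨T, h, hT⟩
  | cons w ws ih =>
    rw [covers, Bool.or_eq_true, Bool.and_eq_true, Bool.or_eq_true] at h
    rcases h with h | ⟨h₁, h₂⟩
    · exact ⟨T, h, hT⟩
    have shift : ∀ t : Finset ℕ, ∑ j ∈ t.map ⟨Nat.succ, Nat.succ_injective⟩, (w :: ws).getD j 0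
        = ∑ j ∈ t, ws.getD j 0 := by
      intro t
      rw [Finset.sum_map]
      rfl
    have hsub : ∀ t : Finset ℕ, t ⊆ Finset.range ws.length →
        t.map ⟨Nat.succ, Nat.succ_injective⟩ ⊆ Finset.range (w :: ws).length := by
      intro t ht j hj
      obtain ⟨a, ha, rfl⟩ := Finset.mem_map.1 hj
      have := Finset.mem_range.1 (ht ha)
      simpa using this
    have hnot : ∀ t : Finset ℕ, (∀ j ∈ t, ¬ S (i + 1 + j)) →
        ∀ j ∈ t.map ⟨Nat.succ, Nat.succ_injective⟩, ¬ S (i + j) := by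
      intro t ht j hj
      obtain ⟨a, ha, rfl⟩ := Finset.mem_map.1 hj
      have := ht a ha
      rwa [show i + 1 + a = i + (a + 1) by omega] at this
    by_cases hi : S i
    · refine ih (i + 1) _ s h₁ ?_ ?_
      · intro j hj
        rw [Nat.testBit_or, Bool.or_eq_true] at hj
        rcases hj with hj | hj
        · exact hT j hj
        · rw [Nat.testBit_two_pow] at hj
          have : i = j := by simpa using hj
          exact this ▸ hi
      · intro t ht hSt
        rw [← shift]
        exact hs _ (hsub t ht) (hnot t hSt)
    · have hext : ∀ t : Finset ℕ, t ⊆ Finset.range ws.length → (∀ j ∈ t, ¬ S (i + 1 + j)) →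
          w + ∑ j ∈ t, ws.getD j 0 ≤ s := by
        intro t ht hSt
        have h0 : 0 ∉ t.map ⟨Nat.succ, Nat.succ_injective⟩ := by simp
        have := hs (insert 0 (t.map ⟨Nat.succ, Nat.succ_injective⟩)) ?_ ?_
        · rw [Finset.sum_insert h0, shift] at this
          simpa using this
        · intro j hj
          rcases Finset.mem_insert.1 hj with rfl | hj
          · simp
          · exact hsub t ht hj
        · intro j hj
          rcases Finset.mem_insert.1 hj with rfl | hj
          · simpa using hi
          · exact hnot t hSt j hj
      have hw : w ≤ s := by simpa using hext ∅ (by simp) (by simp)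
      rcases h₂ with h₂ | h₂
      · exact absurd (Nat.blt_eq.mp h₂) (not_lt.2 hw)
      · refine ih (i + 1) T (s - w) h₂ hT ?_
        intro t ht hSt
        have := hext t ht hSt
        omega

/-- A certificate produces a vertex that sees all of some set in `branches`. -/
theorem exists_adj_of_certifies [Fintype V] (hG : LocallyBipartite G) (hd : LargeDegree G) {k : ℕ}
    (hk : NoClosedChain G k) {A : List ℕ} (hA : Realizes G f fun i => A.getD i 0)
    {far : List (ℕ × ℕ)}
    (hfar : ∀ p ∈ far, p.1 < A.length ∧ p.2 < A.length ∧ ¬ DenseChain G 2 (f p.1) (f p.2))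
    {ext : List ℕ} (hext : ∀ m ∈ ext, ∀ x, ¬ ∀ i, m.testBit i = true → G.Adj x (f i))
    {chains walks : List (ℕ × ℕ × List ℕ)} {branches : List ℕ} (ws : List ℕ)
    (hc : certifies A far k ext chains walks branches ws = true) :
    ∃ x, ∃ m ∈ branches, ∀ i, m.testBit i = true → G.Adj x (f i) := by
  simp only [certifies, Bool.and_eq_true, List.all_eq_true] at hc
  obtain ⟨⟨⟨⟨hlt, hch⟩, hwk⟩, hsum⟩, hcov⟩ := hc
  have hlt' : ∀ a ∈ A, a < 2 ^ A.length := fun a ha => Nat.blt_eq.mp (hlt a ha)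
  have hsum := Nat.blt_eq.mp hsum
  have hws : ∑ j ∈ Finset.range ws.length, ws.getD j 0 = ws.sum := by
    rw [Finset.sum_range, ← Fin.sum_univ_getElem ws]
    exact Finset.sum_congr rfl fun j _ => by simp
  obtain ⟨x, hx⟩ := hd.exists_heavy (Finset.range ws.length) f (fun j => ws.getD j 0)
    (by rw [hws]; exact hsum)
  -- For total weight `W > 0`, the budget `(5 * W - 1) / 11` is the largest integer `s` with `11 * s
  -- < 5 * W`.
  obtain ⟨T, hT, hadj⟩ := exists_hit_of_covers (S := fun j => G.Adj x (f j)) ws 0 0 _ hcov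
    (by simp) (by
      intro t ht hSt
      have := hx t ht (by simpa using hSt)
      rw [hws] at this
      omega)
  have hsubset : ∀ m, (m &&& T == m) = true → ∀ i, m.testBit i = true → G.Adj x (f i) := by
    intro m hm i hi
    apply hadj
    rw [beq_iff_eq] at hm
    rw [← hm, Nat.testBit_and, Bool.and_eq_true] at hi
    exact hi.2
  simp only [Bool.or_eq_true, List.any_eq_true] at hT
  rcases hT with ((⟨m, hm, hmT⟩ | ⟨m, hm, hmT⟩) | ⟨c, hc, hcT⟩) | ⟨c, hc, hcT⟩
  · exact ⟨x, m, hm, hsubset m hmT⟩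
  · exact absurd (hsubset m hmT) (hext m hm x)
  · exact absurd (hsubset _ hcT) (not_adj_of_chainRefutes hd hk hA hlt' hfar (hch c hc) x)
  · exact absurd (hsubset _ hcT) (not_adj_of_walkRefutes hG hA (hwk c hc) x)

/-- The rows `A` only contain the edges in `E`. -/
theorem realizes_of_edges {A : List ℕ} (E : List (ℕ × ℕ)) (hE : ∀ e ∈ E, G.Adj (f e.1) (f e.2))
    (h : ((List.range A.length).all fun i => Nat.blt (A.getD i 0) (2 ^ A.length) &&
      (List.range A.length).all fun j =>
      !(A.getD i 0).testBit j || E.contains (i, j) || E.contains (j, i)) = true) :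
    Realizes G f fun i => A.getD i 0 := by
  intro i j hij
  simp only [List.all_eq_true, List.mem_range, Bool.and_eq_true, Bool.or_eq_true,
    Bool.not_eq_true', List.contains_iff_mem] at h
  rcases lt_or_ge i A.length with hi | hi
  · obtain ⟨hlt, h⟩ := h i hi
    have hj : j < A.length := by
      by_contra hcon
      have := Nat.testBit_lt_two_pow (lt_of_lt_of_le (Nat.blt_eq.mp hlt)
        (Nat.pow_le_pow_right two_pos (not_lt.1 hcon)))
      exact absurd (this.symm.trans hij) (by simp)
    rcases h j hj with (h | h) | h
    · exact absurd (h.symm.trans hij) (by simp)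
    · exact hE _ h
    · exact (hE _ h).symm
  · have hij : (A.getD i 0).testBit j = true := hij
    rw [List.getD_eq_default _ _ hi, Nat.zero_testBit] at hij
    exact absurd hij (by simp)

end Soundness

/-- A certificate for a pattern that is realized by the list of vertices `L` produces a vertex that
sees all of some set in `branches`. -/
theorem exists_adj_of_pattern {V : Type*} [Fintype V] {G : SimpleGraph V}
    (hG : LocallyBipartite G) (hd : LargeDegree G) {k : ℕ} (hk : NoClosedChain G k) {v₀ : V}
    (L : List V) (E : List (ℕ × ℕ)) (hE : ∀ e ∈ E, G.Adj (L.getD e.1 v₀) (L.getD e.2 v₀))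
    (A : List ℕ) (far : List (ℕ × ℕ))
    (hfar : ∀ p ∈ far, ¬ DenseChain G 2 (L.getD p.1 v₀) (L.getD p.2 v₀))
    (ext : List ℕ)
    (hext : ∀ m ∈ ext, ∀ x, ¬ ∀ i, m.testBit i = true → G.Adj x (L.getD i v₀))
    (chains walks : List (ℕ × ℕ × List ℕ)) (branches ws : List ℕ)
    (hc : (certifies A far k ext chains walks branches ws &&
      far.all (fun p => Nat.blt p.1 A.length && Nat.blt p.2 A.length) &&
      (List.range A.length).all fun i => Nat.blt (A.getD i 0) (2 ^ A.length) &&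
      (List.range A.length).all fun j =>
      !(A.getD i 0).testBit j || E.contains (i, j) || E.contains (j, i)) = true) :
    ∃ x, ∃ m ∈ branches, ∀ i, m.testBit i = true → G.Adj x (L.getD i v₀) := by
  rw [Bool.and_eq_true, Bool.and_eq_true, List.all_eq_true] at hc
  refine exists_adj_of_certifies (f := fun i => L.getD i v₀) hG hd hk
    (realizes_of_edges E hE hc.2) (fun p hp => ?_) hext ws hc.1.1
  have h := hc.1.2 p hp
  rw [Bool.and_eq_true] at h
  exact ⟨Nat.blt_eq.mp h.1, Nat.blt_eq.mp h.2, hfar p hp⟩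

/-! ### Closed chains of three and four dense pairs -/

theorem LargeDegree.noClosedChain_mono {V : Type*} [Fintype V] {G : SimpleGraph V}
    (hd : LargeDegree G) {j k : ℕ} (hjk : j ≤ k) (h : NoClosedChain G k) : NoClosedChain G j :=
  fun u v huv => h u v (hd.chain_mono hjk huv)

/-- One of the diagonals of a 4-cycle is dense. -/
theorem LargeDegree.isDense_or_isDense {V : Type*} [Fintype V] {G : SimpleGraph V}
    (hd : LargeDegree G) (hG : LocallyBipartite G) {a b c d : V} (hab : G.Adj a b)
    (hbc : G.Adj b c) (hcd : G.Adj c d) (had : G.Adj a d) : IsDense G a c ∨ IsDense G b d := by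
  have h0 : NoClosedChain G 0 := by rintro u _ rfl; exact G.irrefl
  -- With unit weights the budget is 1, so some vertex sees three consecutive vertices of the cycle;
  -- together with the middle one it forms the edge that makes a diagonal dense.
  obtain ⟨x, m, hm, hx⟩ := exists_adj_of_pattern hG hd h0 (v₀ := a) [a, b, c, d]
    [(0, 1), (1, 2), (2, 3), (0, 3)] (by simp [hab, hbc, hcd, had]) [10, 5, 10, 5] [] (by simp) []
    (by simp) [] [] [7, 11, 13, 14] [1, 1, 1, 1] (by decide +kernel)
  simp only [List.mem_cons, List.not_mem_nil, or_false] at hm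
  rcases hm with rfl | rfl | rfl | rfl
  · have h0 : G.Adj x a := hx 0 rfl
    have h1 : G.Adj x b := hx 1 rfl
    have h2 : G.Adj x c := hx 2 rfl
    exact Or.inl ⟨b, x, h1.symm, hab, h0.symm, hbc.symm, h2.symm⟩
  · have h0 : G.Adj x a := hx 0 rfl
    have h1 : G.Adj x b := hx 1 rfl
    have h2 : G.Adj x d := hx 3 rfl
    exact Or.inr ⟨a, x, h0.symm, hab.symm, h1.symm, had.symm, h2.symm⟩
  · have h0 : G.Adj x a := hx 0 rfl
    have h1 : G.Adj x c := hx 2 rfl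
    have h2 : G.Adj x d := hx 3 rfl
    exact Or.inl ⟨d, x, h2.symm, had, h0.symm, hcd, h1.symm⟩
  · have h0 : G.Adj x b := hx 1 rfl
    have h1 : G.Adj x c := hx 2 rfl
    have h2 : G.Adj x d := hx 3 rfl
    exact Or.inr ⟨c, x, h1.symm, hbc, h0.symm, hcd.symm, h2.symm⟩

/-- Eleven unit weights leave a budget of four, so some vertex sees seven of these vertices. Such a
set is excluded by a short closed chain, or it contains a 7-cycle `b q a d u c r`, up to exchanging
`p, q` and `t, u`. -/
theorem false_of_closed_chain_three {V : Type*} [Fintype V] {G : SimpleGraph V}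
    (hG : LocallyBipartite G) (hd : LargeDegree G) (hk : NoClosedChain G 2)
    {a b c d p q r s t u x : V} (hpq : G.Adj p q) (hap : G.Adj a p) (haq : G.Adj a q)
    (hbp : G.Adj b p) (hbq : G.Adj b q) (hrs : G.Adj r s) (hbr : G.Adj b r) (hbs : G.Adj b s)
    (hcr : G.Adj c r) (hcs : G.Adj c s) (htu : G.Adj t u) (hct : G.Adj c t) (hcu : G.Adj c u)
    (hdt : G.Adj d t) (hdu : G.Adj d u) (had : G.Adj a d) (hxa : G.Adj x a) (hxd : G.Adj x d)
    (hxr : G.Adj x r) : False := by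
  obtain ⟨_, m, hm, -⟩ := exists_adj_of_pattern hG hd hk (v₀ := a)
      [x, r, c, a, s, d, u, t, b, q, p]
      [(0, 1), (0, 3), (0, 5), (1, 2), (1, 4), (1, 8), (2, 4), (2, 6), (2, 7), (3, 5), (3, 9),
       (3, 10), (4, 8), (5, 6), (5, 7), (6, 7), (8, 9), (8, 10), (9, 10)] (by
        simp only [List.forall_mem_cons, List.not_mem_nil, false_imp_iff, implies_true, and_true]
        and_intros <;>
          first | assumption | (apply SimpleGraph.Adj.symm; assumption))
      [42, 277, 210, 1569, 262, 201, 164, 100, 1554, 1288, 776] [] (by simp)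
      [] (by simp)
      [(11, 1, [3, 8]), (13, 2, [5, 11]), (22, 1, [2]), (41, 0, [3]), (50, 5, [2, 11]),
       (196, 2, [6]), (259, 0, [8, 3]), (289, 8, [3, 11]), (448, 8, [2, 11]), (1540, 2, [8, 11]),
       (1544, 3, [9]), (60, 0, [11, 1]), (1728, 3, [11, 5])]
      [(878, 8, [9, 3, 5, 6, 2, 1]), (942, 8, [9, 3, 5, 7, 2, 1]),
       (1390, 8, [10, 3, 5, 6, 2, 1]), (1454, 8, [10, 3, 5, 7, 2, 1])] []
      [1, 1, 1, 1, 1, 1, 1, 1, 1, 1, 1] (by decide +kernel)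
  simp at hm

theorem LargeDegree.noClosedChain_three {V : Type*} [Fintype V] {G : SimpleGraph V}
    (hd : LargeDegree G) (hG : LocallyBipartite G) (hk : NoClosedChain G 2) :
    NoClosedChain G 3 := by
  rintro a _ ⟨b, ⟨p, q, hpq, hap, haq, hbp, hbq⟩, c, ⟨r, s, hrs, hbr, hbs, hcr, hcs⟩, d,
    ⟨t, u, htu, hct, hcu, hdt, hdu⟩, rfl⟩ had
  -- Some vertex `x` sees three of `a, d, r, s`. Seeing both `r` and `s` would make `x` dense to `b`
  -- and to `c`, closing a 2-chain at `a` or `d`; so `x` sees `a`, `d` and one of `r, s`.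
  obtain ⟨x, m, hm, hx⟩ := exists_adj_of_pattern hG hd hk (v₀ := a)
      [a, r, d, s, b, u, p, q, c, t]
      [(0, 2), (0, 6), (0, 7), (1, 3), (1, 4), (1, 8), (2, 5), (2, 9), (3, 4), (3, 8), (4, 6),
       (4, 7), (5, 8), (5, 9), (6, 7), (8, 9)] (by
        simp only [List.forall_mem_cons, List.not_mem_nil, false_imp_iff, implies_true, and_true]
        and_intros <;>
          first | assumption | (apply SimpleGraph.Adj.symm; assumption))
      [196, 280, 545, 274, 202, 772, 145, 81, 554, 292] [] (by simp)
      [] (by simp)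
      [(11, 0, [4, 10]), (14, 2, [8, 10])]
      [] [7, 13]
      [1, 1, 1, 1, 0, 0, 0, 0, 0, 0] (by decide +kernel)
  simp only [List.mem_cons, List.not_mem_nil, or_false] at hm
  rcases hm with rfl | rfl
  · exact false_of_closed_chain_three hG hd hk hpq hap haq hbp hbq hrs hbr hbs hcr hcs htu hct hcu
      hdt hdu had (hx 0 rfl) (hx 2 rfl) (hx 1 rfl)
  · exact false_of_closed_chain_three hG hd hk hpq hap haq hbp hbq hrs.symm hbs hbr hcs hcr htu hct
      hcu hdt hdu had (hx 0 rfl) (hx 2 rfl) (hx 3 rfl)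

/-- The analogue with fifteen unit weights and budget six: the odd closed walks are now 9-cycles `p
b r c u d w e a`, up to exchanging the inner vertices of the diamonds. -/
theorem false_of_closed_chain_four {V : Type*} [Fintype V] {G : SimpleGraph V}
    (hG : LocallyBipartite G) (hd : LargeDegree G) (hk : NoClosedChain G 3)
    {a b c d e p q r s t u v w x : V} (hpq : G.Adj p q) (hap : G.Adj a p) (haq : G.Adj a q)
    (hbp : G.Adj b p) (hbq : G.Adj b q) (hrs : G.Adj r s) (hbr : G.Adj b r) (hbs : G.Adj b s)
    (hcr : G.Adj c r) (hcs : G.Adj c s) (htu : G.Adj t u) (hct : G.Adj c t) (hcu : G.Adj c u)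
    (hdt : G.Adj d t) (hdu : G.Adj d u) (hvw : G.Adj v w) (hdv : G.Adj d v) (hdw : G.Adj d w)
    (hev : G.Adj e v) (hew : G.Adj e w) (hae : G.Adj a e) (hxa : G.Adj x a) (hxe : G.Adj x e)
    (hxr : G.Adj x r) : False := by
  -- The vertex `y` raises the total weight from 14 to 15 while the budget stays six, so nine
  -- vertices are seen instead of eight.
  obtain ⟨y, hby, hdy⟩ := hd.exists_common b d
  obtain ⟨_, m, hm, -⟩ := exists_adj_of_pattern hG hd hk (v₀ := a)
      [x, a, r, c, e, s, u, t, b, p, q, w, v, d, y]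
      [(0, 1), (0, 2), (0, 4), (1, 4), (1, 9), (1, 10), (2, 3), (2, 5), (2, 8), (3, 5), (3, 6),
       (3, 7), (4, 11), (4, 12), (5, 8), (6, 7), (6, 13), (7, 13), (8, 9), (8, 10), (8, 14),
       (9, 10), (11, 12), (11, 13), (12, 13), (13, 14)] (by
        simp only [List.forall_mem_cons, List.not_mem_nil, false_imp_iff, implies_true, and_true]
        and_intros <;>
          first | assumption | (apply SimpleGraph.Adj.symm; assumption))
      [22, 1553, 297, 228, 6147, 268, 8328, 8264, 17956, 1282, 770, 12304, 10256, 22720,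
       8448] [] (by simp)
      [] (by simp)
      [(7, 2, [1, 8]), (11, 3, [13, 4, 15]), (13, 0, [3, 8, 1]), (19, 0, [1]),
       (25, 3, [8, 1, 15]), (38, 1, [8, 15]), (52, 4, [13, 3, 15]), (194, 1, [8, 3, 15]),
       (200, 3, [6]), (261, 0, [8, 1]), (273, 8, [1, 15]), (1538, 1, [9]), (1544, 3, [8, 15]),
       (6152, 3, [13, 15]), (6160, 4, [11]), (6400, 8, [3, 13, 15]), (8195, 13, [4, 15]),
       (8384, 6, [7]), (9728, 13, [3, 8, 15]), (24832, 1, [8, 13, 4]), (58, 0, [15, 2]),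
       (1728, 1, [15, 13, 4]), (6180, 1, [8, 15, 4]), (17170, 13, [4, 9, 14]),
       (17682, 13, [4, 10, 14]), (26642, 8, [1, 11, 14]), (28690, 8, [1, 12, 14])]
      [(11102, 9, [8, 2, 3, 6, 13, 11, 4, 1]), (11166, 9, [8, 2, 3, 7, 13, 11, 4, 1]),
       (11614, 10, [8, 2, 3, 6, 13, 11, 4, 1]), (11678, 10, [8, 2, 3, 7, 13, 11, 4, 1]),
       (13150, 9, [8, 2, 3, 6, 13, 12, 4, 1]), (13214, 9, [8, 2, 3, 7, 13, 12, 4, 1]),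
       (13662, 10, [8, 2, 3, 6, 13, 12, 4, 1]), (13726, 10, [8, 2, 3, 7, 13, 12, 4, 1])] []
      [1, 1, 1, 1, 1, 1, 1, 1, 1, 1, 1, 1, 1, 1, 1] (by decide +kernel)
  simp at hm

theorem LargeDegree.noClosedChain_four {V : Type*} [Fintype V] {G : SimpleGraph V}
    (hd : LargeDegree G) (hG : LocallyBipartite G) (hk : NoClosedChain G 3) :
    NoClosedChain G 4 := by
  rintro a _ ⟨b, ⟨p, q, hpq, hap, haq, hbp, hbq⟩, c, ⟨r, s, hrs, hbr, hbs, hcr, hcs⟩, d,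
    ⟨t, u, htu, hct, hcu, hdt, hdu⟩, e, ⟨v, w, hvw, hdv, hdw, hev, hew⟩, rfl⟩ hae
  obtain ⟨x, m, hm, hx⟩ := exists_adj_of_pattern hG hd hk (v₀ := a)
      [a, e, r, s, w, b, d, u, q, t, c, p, v]
      [(0, 1), (0, 8), (0, 11), (1, 4), (1, 12), (2, 3), (2, 5), (2, 10), (3, 5), (3, 10),
       (4, 6), (4, 12), (5, 8), (5, 11), (6, 7), (6, 9), (6, 12), (7, 9), (7, 10), (8, 11),
       (9, 10)] (by
        simp only [List.forall_mem_cons, List.not_mem_nil, false_imp_iff, implies_true, and_true]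
        and_intros <;>
          first | assumption | (apply SimpleGraph.Adj.symm; assumption))
      [2306, 4113, 1064, 1060, 4162, 2316, 4752, 1600, 2081, 1216, 652, 289, 82] [] (by simp)
      [] (by simp)
      [(13, 0, [5, 13]), (14, 1, [6, 10, 13])]
      [] [7, 11]
      [1, 1, 1, 1, 0, 0, 0, 0, 0, 0, 0, 0, 0] (by decide +kernel)
  simp only [List.mem_cons, List.not_mem_nil, or_false] at hm
  rcases hm with rfl | rfl
  · exact false_of_closed_chain_four hG hd hk hpq hap haq hbp hbq hrs hbr hbs hcr hcs htu hct hcu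
      hdt hdu hvw hdv hdw hev hew hae (hx 0 rfl) (hx 1 rfl) (hx 2 rfl)
  · exact false_of_closed_chain_four hG hd hk hpq hap haq hbp hbq hrs.symm hbs hbr hcs hcr htu hct
      hcu hdt hdu hvw hdv hdw hev hew hae (hx 0 rfl) (hx 1 rfl) (hx 3 rfl)

/-! ### Spindles lacking one edge -/

/-- This covers the Moser spindles that lack only an edge `uv` between an end of a diamond and an
inner vertex, where the end has degree three in the spindle. -/
theorem LargeDegree.denseChain_two_of_adj_of_isDense {V : Type*} [Fintype V] {G : SimpleGraph V}
    (hd : LargeDegree G) (hG : LocallyBipartite G) (hk : NoClosedChain G 2) {u v w y z : V}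
    (huw : G.Adj u w) (huy : G.Adj u y) (hwy : G.Adj w y) (hvw : G.Adj v w) (hvz : G.Adj v z)
    (hzy : IsDense G z y) : DenseChain G 2 u v := by
  by_contra hfar
  obtain ⟨p, q, hpq, hzp, hzq, hyp, hyq⟩ := hzy
  obtain ⟨x, m, hm, hx⟩ := exists_adj_of_pattern hG hd hk (v₀ := u)
      [w, y, u, v, z, p, q]
      [(0, 1), (0, 2), (0, 3), (1, 2), (1, 5), (1, 6), (3, 4), (4, 5), (4, 6), (5, 6)] (by
        simp only [List.forall_mem_cons, List.not_mem_nil, false_imp_iff, implies_true, and_true]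
        and_intros <;>
          first | assumption | (apply SimpleGraph.Adj.symm; assumption))
      [14, 101, 3, 17, 104, 82, 50] [(2, 3)] (by simpa using hfar)
      [] (by simp)
      [(7, 0, [1]), (11, 3, [1, 4]), (13, 2, [3]), (21, 4, [1, 7]), (25, 0, [4, 1])]
      [] [19, 30]
      -- The budget is two, and `w` weighs two: either `w` alone is missed, or `w` and at least two
      -- of `y, u, v, z` are seen.
      [2, 1, 1, 1, 1, 0, 0] (by decide +kernel)
  simp only [List.mem_cons, List.not_mem_nil, or_false] at hm
  rcases hm with rfl | rfl
  · have hxw : G.Adj x w := hx 0 rfl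
    have hxy : G.Adj x y := hx 1 rfl
    have hxz : G.Adj x z := hx 4 rfl
    obtain ⟨_, m, hm, -⟩ := exists_adj_of_pattern hG hd hk (v₀ := u)
      [x, z, w, v, u, y, q, p]
      [(0, 1), (0, 2), (0, 5), (1, 3), (1, 6), (1, 7), (2, 3), (2, 4), (2, 5), (4, 5), (5, 6),
       (5, 7), (6, 7)] (by
        simp only [List.forall_mem_cons, List.not_mem_nil, false_imp_iff, implies_true, and_true]
        and_intros <;>
          first | assumption | (apply SimpleGraph.Adj.symm; assumption))
      [38, 201, 57, 6, 36, 213, 162, 98] [(4, 3)] (by simpa using hfar)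
      [] (by simp)
      [(7, 1, [5, 8]), (11, 4, [0, 3]), (13, 4, [0, 3]), (14, 2, [1, 5])]
      [] []
      [1, 1, 1, 1, 0, 0, 0, 0] (by decide +kernel)
    simp at hm
  · have hxy : G.Adj x y := hx 1 rfl
    have hxu : G.Adj x u := hx 2 rfl
    have hxv : G.Adj x v := hx 3 rfl
    have hxz : G.Adj x z := hx 4 rfl
    obtain ⟨_, m, hm, -⟩ := exists_adj_of_pattern hG hd hk (v₀ := u)
      [q, x, y, z, v, u, p, w]
      [(0, 2), (0, 3), (0, 6), (1, 2), (1, 3), (1, 4), (1, 5), (2, 5), (2, 6), (2, 7), (3, 4),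
       (3, 6), (4, 7), (5, 7)] (by
        simp only [List.forall_mem_cons, List.not_mem_nil, false_imp_iff, implies_true, and_true]
        and_intros <;>
          first | assumption | (apply SimpleGraph.Adj.symm; assumption))
      [76, 60, 227, 83, 138, 134, 13, 52] [(5, 4)] (by simpa using hfar)
      [] (by simp)
      [(14, 5, [8, 4]), (22, 2, [3, 8]), (26, 1, [3]), (38, 1, [2]), (42, 2, [3, 5]),
       (50, 5, [4]), (69, 0, [2]), (73, 0, [3]), (61, 5, [0, 4]), (124, 5, [6, 4])]
      [] []
      [1, 3, 2, 2, 1, 1, 1, 0] (by decide +kernel)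
    simp at hm

/-- This covers the Moser spindles that lack only an edge `uv` at the vertex `v` of degree four. -/
theorem LargeDegree.denseChain_two_of_isDense_of_adj {V : Type*} [Fintype V] {G : SimpleGraph V}
    (hd : LargeDegree G) (hG : LocallyBipartite G) (hk : NoClosedChain G 2) {u v w y z : V}
    (huw : G.Adj u w) (huy : G.Adj u y) (hwy : G.Adj w y) (hvw : G.Adj v w) (hyz : G.Adj y z)
    (hzv : IsDense G z v) : DenseChain G 2 u v := by
  by_contra hfar
  obtain ⟨p, q, hpq, hzp, hzq, hvp, hvq⟩ := hzv
  obtain ⟨_, m, hm, -⟩ := exists_adj_of_pattern hG hd hk (v₀ := u)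
      [y, z, w, q, p, u, v]
      [(0, 1), (0, 2), (0, 5), (1, 3), (1, 4), (2, 5), (2, 6), (3, 4), (3, 6), (4, 6)] (by
        simp only [List.forall_mem_cons, List.not_mem_nil, false_imp_iff, implies_true, and_true]
        and_intros <;>
          first | assumption | (apply SimpleGraph.Adj.symm; assumption))
      [38, 25, 97, 82, 74, 5, 28] [(5, 6)] (by simpa using hfar)
      [] (by simp)
      [(7, 2, [1, 6]), (26, 1, [3]), (35, 5, [1, 6]), (37, 0, [2]), (69, 0, [6, 1]),
       (88, 3, [4]), (100, 5, [6]), (29, 5, [7, 6]), (57, 2, [7, 6]), (60, 0, [7, 1])]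
      [] []
      [2, 1, 2, 2, 2, 1, 1] (by decide +kernel)
  simp at hm

/-! ### Long geodesics in a neighbourhood -/

/-- In the neighbourhood of a vertex, a path such that only vertices at distance at most two on
the path have common neighbours has at most nine vertices. -/
theorem LargeDegree.false_of_long_path {V : Type*} [Fintype V] {G : SimpleGraph V}
    (hd : LargeDegree G) (hG : LocallyBipartite G) (hk : NoClosedChain G 2) {h : V} {c : ℕ → V}
    (hh : ∀ i < 10, G.Adj h (c i)) (hc : ∀ i < 9, G.Adj (c i) (c (i + 1)))
    (hfar : ∀ i j x, i + 3 ≤ j → j < 10 → G.Adj x h → G.Adj x (c i) → ¬ G.Adj x (c j)) :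
    False := by
  obtain ⟨_, m, hm, -⟩ := exists_adj_of_pattern hG hd hk (v₀ := h)
      [h, c 1, c 8, c 5, c 9, c 0, c 4, c 2, c 6, c 3, c 7]
      [(0, 1), (0, 2), (0, 3), (0, 4), (0, 5), (0, 6), (0, 7), (0, 8), (0, 9), (0, 10), (1, 5),
       (1, 7), (2, 4), (2, 10), (3, 6), (3, 8), (6, 9), (7, 9), (8, 10)] (by
        simp only [List.forall_mem_cons, List.not_mem_nil, false_imp_iff, implies_true, and_true]
        and_intros <;>
          first | exact hh _ (by norm_num) | exact hc _ (by norm_num) | exact (hc _ (by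
           norm_num)).symm)
      [2046, 161, 1041, 321, 5, 3, 521, 515, 1033, 193, 261] [] (by simp)
      [97, 41, 37, 49, 67, 11, 7, 19, 69, 81, 13, 25] (by
        simp only [List.forall_mem_cons, List.not_mem_nil, false_imp_iff, implies_true, and_true]
        exact ⟨fun x hx => hfar 0 4 x (by norm_num) (by norm_num) (hx 0 rfl) (hx 5 rfl) (hx 6 rfl),
          fun x hx => hfar 0 5 x (by norm_num) (by norm_num) (hx 0 rfl) (hx 5 rfl) (hx 3 rfl),
          fun x hx => hfar 0 8 x (by norm_num) (by norm_num) (hx 0 rfl) (hx 5 rfl) (hx 2 rfl),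
          fun x hx => hfar 0 9 x (by norm_num) (by norm_num) (hx 0 rfl) (hx 5 rfl) (hx 4 rfl),
          fun x hx => hfar 1 4 x (by norm_num) (by norm_num) (hx 0 rfl) (hx 1 rfl) (hx 6 rfl),
          fun x hx => hfar 1 5 x (by norm_num) (by norm_num) (hx 0 rfl) (hx 1 rfl) (hx 3 rfl),
          fun x hx => hfar 1 8 x (by norm_num) (by norm_num) (hx 0 rfl) (hx 1 rfl) (hx 2 rfl),
          fun x hx => hfar 1 9 x (by norm_num) (by norm_num) (hx 0 rfl) (hx 1 rfl) (hx 4 rfl),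
          fun x hx => hfar 4 8 x (by norm_num) (by norm_num) (hx 0 rfl) (hx 6 rfl) (hx 2 rfl),
          fun x hx => hfar 4 9 x (by norm_num) (by norm_num) (hx 0 rfl) (hx 6 rfl) (hx 4 rfl),
          fun x hx => hfar 5 8 x (by norm_num) (by norm_num) (hx 0 rfl) (hx 3 rfl) (hx 2 rfl),
          fun x hx => hfar 5 9 x (by norm_num) (by norm_num) (hx 0 rfl) (hx 3 rfl) (hx 4 rfl)⟩)
      [(21, 0, [2]), (35, 0, [1]), (73, 0, [3])]
      [] []
      -- The budget is four, so `h` and two of `c 0, c 1, c 4, c 5, c 8, c 9` are seen. Those two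
      -- are consecutive, giving a `K₄` with `h`, or at distance at least three on the path.
      [5, 1, 1, 1, 1, 1, 1, 0, 0, 0, 0] (by decide +kernel)
  simp at hm

/-- A geodesic with nine vertices in a neighbourhood is not closed by a dense pair and an edge. -/
theorem LargeDegree.false_of_path_nine {V : Type*} [Fintype V] {G : SimpleGraph V}
    (hd : LargeDegree G) (hG : LocallyBipartite G) (hk : NoClosedChain G 4) {h d : V} {c : ℕ → V}
    (hh : ∀ i < 9, G.Adj h (c i)) (hc : ∀ i < 8, G.Adj (c i) (c (i + 1)))
    (hfar : ∀ i j x, i + 3 ≤ j → j < 9 → G.Adj x h → G.Adj x (c i) → ¬ G.Adj x (c j))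
    (hd0 : G.Adj d (c 0)) (hd8 : IsDense G d (c 8)) : False := by
  obtain ⟨p, q, hpq, hdp, hdq, hcp, hcq⟩ := hd8
  obtain ⟨_, m, hm, -⟩ := exists_adj_of_pattern hG hd hk (v₀ := h)
      [c 1, h, c 7, c 8, c 0, c 3, c 4, c 6, c 2, c 5, d, p, q]
      [(0, 1), (0, 4), (0, 8), (1, 2), (1, 3), (1, 4), (1, 5), (1, 6), (1, 7), (1, 8), (1, 9),
       (2, 3), (2, 7), (3, 11), (3, 12), (4, 10), (5, 6), (5, 8), (6, 9), (7, 9), (10, 11),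
       (10, 12), (11, 12)] (by
        simp only [List.forall_mem_cons, List.not_mem_nil, false_imp_iff, implies_true, and_true]
        and_intros <;>
          first
            | assumption
            | exact hh _ (by norm_num)
            | exact hc _ (by norm_num)
            | exact (hh _ (by norm_num)).symm
            | exact (hc _ (by norm_num)).symm
            | (apply SimpleGraph.Adj.symm; assumption))
      [274, 1021, 138, 6150, 1027, 322, 546, 518, 35, 194, 6160, 5128, 3080] [] (by simp)
      [50, 82, 530, 146, 22, 26, 67, 515, 131, 7, 11, 770, 386, 262, 266, 162, 38, 42, 70, 74,
       522] (by
        simp only [List.forall_mem_cons, List.not_mem_nil, false_imp_iff, implies_true, and_true]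
        exact ⟨fun x hx => hfar 0 3 x (by norm_num) (by norm_num) (hx 1 rfl) (hx 4 rfl) (hx 5 rfl),
          fun x hx => hfar 0 4 x (by norm_num) (by norm_num) (hx 1 rfl) (hx 4 rfl) (hx 6 rfl),
          fun x hx => hfar 0 5 x (by norm_num) (by norm_num) (hx 1 rfl) (hx 4 rfl) (hx 9 rfl),
          fun x hx => hfar 0 6 x (by norm_num) (by norm_num) (hx 1 rfl) (hx 4 rfl) (hx 7 rfl),
          fun x hx => hfar 0 7 x (by norm_num) (by norm_num) (hx 1 rfl) (hx 4 rfl) (hx 2 rfl),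
          fun x hx => hfar 0 8 x (by norm_num) (by norm_num) (hx 1 rfl) (hx 4 rfl) (hx 3 rfl),
          fun x hx => hfar 1 4 x (by norm_num) (by norm_num) (hx 1 rfl) (hx 0 rfl) (hx 6 rfl),
          fun x hx => hfar 1 5 x (by norm_num) (by norm_num) (hx 1 rfl) (hx 0 rfl) (hx 9 rfl),
          fun x hx => hfar 1 6 x (by norm_num) (by norm_num) (hx 1 rfl) (hx 0 rfl) (hx 7 rfl),
          fun x hx => hfar 1 7 x (by norm_num) (by norm_num) (hx 1 rfl) (hx 0 rfl) (hx 2 rfl),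
          fun x hx => hfar 1 8 x (by norm_num) (by norm_num) (hx 1 rfl) (hx 0 rfl) (hx 3 rfl),
          fun x hx => hfar 2 5 x (by norm_num) (by norm_num) (hx 1 rfl) (hx 8 rfl) (hx 9 rfl),
          fun x hx => hfar 2 6 x (by norm_num) (by norm_num) (hx 1 rfl) (hx 8 rfl) (hx 7 rfl),
          fun x hx => hfar 2 7 x (by norm_num) (by norm_num) (hx 1 rfl) (hx 8 rfl) (hx 2 rfl),
          fun x hx => hfar 2 8 x (by norm_num) (by norm_num) (hx 1 rfl) (hx 8 rfl) (hx 3 rfl),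
          fun x hx => hfar 3 6 x (by norm_num) (by norm_num) (hx 1 rfl) (hx 5 rfl) (hx 7 rfl),
          fun x hx => hfar 3 7 x (by norm_num) (by norm_num) (hx 1 rfl) (hx 5 rfl) (hx 2 rfl),
          fun x hx => hfar 3 8 x (by norm_num) (by norm_num) (hx 1 rfl) (hx 5 rfl) (hx 3 rfl),
          fun x hx => hfar 4 7 x (by norm_num) (by norm_num) (hx 1 rfl) (hx 6 rfl) (hx 2 rfl),
          fun x hx => hfar 4 8 x (by norm_num) (by norm_num) (hx 1 rfl) (hx 6 rfl) (hx 3 rfl),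
          fun x hx => hfar 5 8 x (by norm_num) (by norm_num) (hx 1 rfl) (hx 9 rfl) (hx 3 rfl)⟩)
      [(19, 0, [1]), (259, 0, [1]), (642, 1, [7]), (1030, 10, [3, 13]), (1042, 1, [10, 3]),
       (1058, 10, [3, 7, 6, 13]), (6152, 3, [11]), (6208, 6, [7, 3, 13]),
       (6400, 8, [6, 7, 3, 13]), (6147, 4, [13, 10])]
      [(4093, 8, [5, 6, 9, 7, 2, 3, 11, 10, 4, 0]), (6141, 8, [5, 6, 9, 7, 2, 3, 12, 10, 4, 0])] []
      -- The budget is nine. If `h` is missed, at most one further vertex is, which leaves a short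
      -- closed chain or the 11-cycle formed by `c 0, …, c 8`, one of `p, q`, and `d`. If `h` is
      -- seen, `hfar` restricts the visible `c i` severely.
      [2, 8, 1, 1, 2, 1, 1, 1, 1, 1, 1, 1, 1] (by decide +kernel)
  simp at hm

/-! ### Small odd wheels and copies of the spindle -/

theorem LocallyBipartite.false_of_triangle {V : Type*} {G : SimpleGraph V}
    (hG : LocallyBipartite G) {x a b c : V} (ha : G.Adj x a) (hb : G.Adj x b) (hc : G.Adj x c)
    (hab : G.Adj a b) (hbc : G.Adj b c) (hac : G.Adj a c) : False := by
  obtain ⟨χ, hχ⟩ := hG.exists_bool_coloring x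
  have h1 := hχ _ _ ha hb hab
  have h2 := hχ _ _ hb hc hbc
  have h3 := hχ _ _ ha hc hac
  revert h1 h2 h3
  cases χ a <;> cases χ b <;> cases χ c <;> simp

theorem LocallyBipartite.false_of_pentagon {V : Type*} {G : SimpleGraph V}
    (hG : LocallyBipartite G) {x a b c d e : V} (ha : G.Adj x a) (hb : G.Adj x b)
    (hc : G.Adj x c) (hd : G.Adj x d) (he : G.Adj x e) (hab : G.Adj a b) (hbc : G.Adj b c)
    (hcd : G.Adj c d) (hde : G.Adj d e) (hea : G.Adj e a) : False := by
  obtain ⟨χ, hχ⟩ := hG.exists_bool_coloring x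
  have h1 := hχ _ _ ha hb hab
  have h2 := hχ _ _ hb hc hbc
  have h3 := hχ _ _ hc hd hcd
  have h4 := hχ _ _ hd he hde
  have h5 := hχ _ _ he ha hea
  revert h1 h2 h3 h4 h5
  cases χ a <;> cases χ b <;> cases χ c <;> cases χ d <;> cases χ e <;> simp

theorem locallyBipartite_of_bool_coloring {V : Type*} {G : SimpleGraph V}
    (h : ∀ x, ∃ χ : V → Bool, ∀ u v, G.Adj x u → G.Adj x v → G.Adj u v → χ u ≠ χ v) :
    LocallyBipartite G := by
  intro x
  obtain ⟨χ, hχ⟩ := h x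
  refine ⟨SimpleGraph.Coloring.mk (fun u => if χ u then (0 : Fin 2) else 1) ?_⟩
  rintro ⟨u, hu⟩ ⟨v, hv⟩ huv
  have := hχ u v hu hv (by simpa using huv)
  revert this
  cases χ u <;> cases χ v <;> simp

theorem LocallyBipartite.cliqueFree_four {V : Type*} {G : SimpleGraph V}
    (hG : LocallyBipartite G) : G.CliqueFree 4 := by
  classical
  intro s hs
  obtain ⟨a, b, c, d, hab, hac, had, hbc, hbd, hcd, rfl⟩ := Finset.card_eq_four.1 hs.card_eq
  have h := hs.isClique
  exact hG.false_of_triangle (h (by simp) (by simp) hab) (h (by simp) (by simp) hac)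
    (h (by simp) (by simp) had) (h (by simp) (by simp) hbc) (h (by simp) (by simp) hcd)
    (h (by simp) (by simp) hbd)

/-- The edges of the Moser spindle. -/
theorem moserSpindle_adj {i j : Fin 7} (h : moserSpindle.Adj i j) :
    (i, j) ∈ ([(0, 1), (1, 2), (2, 3), (3, 4), (4, 5), (5, 6), (0, 6), (0, 5), (0, 2), (1, 3),
      (4, 6)] : List (Fin 7 × Fin 7)) ∨
    (j, i) ∈ ([(0, 1), (1, 2), (2, 3), (3, 4), (4, 5), (5, 6), (0, 6), (0, 5), (0, 2), (1, 3),
      (4, 6)] : List (Fin 7 × Fin 7)) := by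
  revert h
  fin_cases i <;> fin_cases j <;> simp [moserSpindle]

theorem moserSpindle_isContained {V : Type*} {G : SimpleGraph V} (f : Fin 7 → V)
    (hf : Function.Injective f)
    (hadj : ∀ p ∈ ([(0, 1), (1, 2), (2, 3), (3, 4), (4, 5), (5, 6), (0, 6), (0, 5), (0, 2), (1, 3),
      (4, 6)] : List (Fin 7 × Fin 7)), G.Adj (f p.1) (f p.2)) :
    moserSpindle.IsContained G :=
  ⟨⟨⟨f, fun h => (moserSpindle_adj h).elim (fun h => hadj _ h) fun h => (hadj _ h).symm⟩,
    hf⟩⟩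

/-- In a locally bipartite graph, all homomorphic images of the Moser spindle are copies. -/
theorem LocallyBipartite.noClosedChain_two {V : Type*} {G : SimpleGraph V}
    (hG : LocallyBipartite G) (hM : ¬ moserSpindle.IsContained G) : NoClosedChain G 2 := by
  rintro a _ ⟨b, ⟨p, q, hpq, hap, haq, hbp, hbq⟩, c, ⟨r, s, hrs, hbr, hbs, hcr, hcs⟩, rfl⟩ hac
  -- Any coincidence would produce a `K₄` or a wheel over a pentagon.
  have hba : b ≠ a := by
    rintro rfl; exact hG.false_of_triangle hbr hbs hac hrs hcs.symm hcr.symm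
  have hbc : b ≠ c := by
    rintro rfl; exact hG.false_of_triangle hbp hbq hac.symm hpq haq.symm hap.symm
  have hpc : p ≠ c := by
    rintro rfl; exact hG.false_of_triangle hbr hbs hbp hrs hcs.symm hcr.symm
  have hqc : q ≠ c := by
    rintro rfl; exact hG.false_of_triangle hbr hbs hbq hrs hcs.symm hcr.symm
  have hra : a ≠ r := by
    rintro rfl; exact hG.false_of_triangle hbp hbq hbr hpq haq.symm hap.symm
  have hsa : a ≠ s := by
    rintro rfl; exact hG.false_of_triangle hbp hbq hbs hpq haq.symm hap.symm
  have hpr : p ≠ r := by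
    rintro rfl
    exact hG.false_of_pentagon hbp.symm hpq hap.symm hcr.symm hrs hbq haq.symm hac hcs hbs.symm
  have hps : p ≠ s := by
    rintro rfl
    exact hG.false_of_pentagon hbp.symm hpq hap.symm hcs.symm hrs.symm hbq haq.symm hac hcr
      hbr.symm
  have hqr : q ≠ r := by
    rintro rfl
    exact hG.false_of_pentagon hbq.symm hpq.symm haq.symm hcr.symm hrs hbp hap.symm hac hcs
      hbs.symm
  have hqs : q ≠ s := by
    rintro rfl
    exact hG.false_of_pentagon hbq.symm hpq.symm haq.symm hcs.symm hrs.symm hbp hap.symm hac hcr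
      hbr.symm
  have hnd : [b, p, q, a, c, r, s].Nodup := by
    simp only [List.nodup_cons, List.mem_cons, List.not_mem_nil, or_false, not_or, not_false_eq_true,
      List.nodup_nil, and_true]
    exact ⟨⟨hbp.ne, hbq.ne, hba, hbc, hbr.ne, hbs.ne⟩,
      ⟨hpq.ne, hap.ne', hpc, hpr, hps⟩, ⟨haq.ne', hqc, hqr, hqs⟩, ⟨hac.ne, hra, hsa⟩,
      ⟨hcr.ne, hcs.ne⟩, hrs.ne⟩
  refine hM (moserSpindle_isContained (fun i => [b, p, q, a, c, r, s].get i)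
    (List.nodup_iff_injective_get.1 hnd) ?_)
  simp only [List.forall_mem_cons, List.not_mem_nil, false_imp_iff, implies_true, and_true]
  exact ⟨hbp, hpq, haq.symm, hac, hcr, hrs, hbs, hbr, hbq, hap.symm, hcs⟩

/-! ### Paths in neighbourhoods -/

/-- The graph induced by the neighbourhood of `h`, on the whole vertex set. -/
def hubGraph {V : Type*} (G : SimpleGraph V) (h : V) : SimpleGraph V where
  Adj a b := G.Adj a b ∧ G.Adj h a ∧ G.Adj h b
  symm := ⟨fun _ _ hab => ⟨hab.1.symm, hab.2.2, hab.2.1⟩⟩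
  loopless := ⟨fun _ ha => G.irrefl ha.1⟩

/-- `c 0, …, c n` is a geodesic in the neighbourhood of `h`. -/
structure IsHubPath {V : Type*} (G : SimpleGraph V) (h : V) (c : ℕ → V) (n : ℕ) : Prop where
  hub : ∀ i ≤ n, G.Adj h (c i)
  adj : ∀ i < n, G.Adj (c i) (c (i + 1))
  far : ∀ i j x, i + 3 ≤ j → j ≤ n → G.Adj x h → G.Adj x (c i) → ¬ G.Adj x (c j)

/-- On a shortest path, a common neighbour of `c i` and `c j` inside the neighbourhood of `h` would
be a detour of length two, impossible when `j ≥ i + 3`. -/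
theorem exists_isHubPath {V : Type*} {G : SimpleGraph V} {h s t : V} (ht : G.Adj h t)
    (hr : (hubGraph G h).Reachable s t) :
    ∃ c n, IsHubPath G h c n ∧ c 0 = s ∧ c n = t := by
  obtain ⟨p, hp⟩ := hr.exists_walk_length_eq_dist
  have hub : ∀ i ≤ p.length, G.Adj h (p.getVert i) := by
    intro i hi
    rcases hi.lt_or_eq with hi | rfl
    · exact (p.adj_getVert_succ hi).2.1
    · rw [p.getVert_length]; exact ht
  refine ⟨p.getVert, p.length, ⟨hub, fun i hi => (p.adj_getVert_succ hi).1, ?_⟩,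
    p.getVert_zero, p.getVert_length⟩
  intro i j x hij hj hxh hxi hxj
  have h1 : (hubGraph G h).Adj (p.getVert i) x := ⟨hxi.symm, hub i (by omega), hxh.symm⟩
  have h2 : (hubGraph G h).Adj x (p.getVert j) := ⟨hxj, hxh.symm, hub j hj⟩
  have hle := SimpleGraph.dist_le
    ((p.take i).append (SimpleGraph.Walk.cons h1 (SimpleGraph.Walk.cons h2 (p.drop j))))
  rw [← hp, SimpleGraph.Walk.length_append, SimpleGraph.Walk.length_cons,
    SimpleGraph.Walk.length_cons, SimpleGraph.Walk.take_length, SimpleGraph.Walk.drop_length]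
    at hle
  omega

theorem IsHubPath.length_le {V : Type*} [Fintype V] {G : SimpleGraph V} {h : V} {c : ℕ → V}
    {n : ℕ} (hp : IsHubPath G h c n) (hd : LargeDegree G) (hG : LocallyBipartite G)
    (hk : NoClosedChain G 2) : n ≤ 8 := by
  by_contra hn
  exact hd.false_of_long_path hG hk (fun i hi => hp.hub i (by omega))
    (fun i hi => hp.adj i (by omega)) fun i j x hij hj => hp.far i j x hij (by omega)

/-- Vertices two steps apart share the edge between `h` and the vertex in the middle. -/
theorem IsHubPath.chain {V : Type*} {G : SimpleGraph V} {h : V} {c : ℕ → V}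
    {n : ℕ} (hp : IsHubPath G h c n) (m : ℕ) (hm : 2 * m ≤ n) :
    DenseChain G m (c 0) (c (2 * m)) := by
  induction m with
  | zero => rfl
  | succ m ih =>
    have h1 := hp.adj (2 * m) (by omega)
    have h2 := hp.adj (2 * m + 1) (by omega)
    have hD : IsDense G (c (2 * m)) (c (2 * (m + 1))) :=
      ⟨h, c (2 * m + 1), hp.hub _ (by omega), (hp.hub _ (by omega)).symm, h1,
        (hp.hub _ (by omega)).symm, h2.symm⟩
    have := (ih (by omega)).trans hD.chain
    rwa [add_comm] at this

theorem IsHubPath.color {V : Type*} {G : SimpleGraph V} {h : V} {c : ℕ → V}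
    {n : ℕ} (hp : IsHubPath G h c n) {χ : V → Bool}
    (hχ : ∀ u v, G.Adj h u → G.Adj h v → G.Adj u v → χ u ≠ χ v) :
    χ (c n) = (χ (c 0) ^^ decide (n % 2 = 1)) := by
  suffices ∀ i ≤ n, χ (c i) = (χ (c 0) ^^ decide (i % 2 = 1)) from this n le_rfl
  intro i hi
  induction i with
  | zero => simp
  | succ i ih =>
    have h1 := hχ _ _ (hp.hub i (by omega)) (hp.hub (i + 1) hi) (hp.adj i (by omega))
    have h2 := ih (by omega)
    have h3 : (i + 1) % 2 = 1 - i % 2 := by omega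
    rw [h3]
    rcases Nat.mod_two_eq_zero_or_one i with h | h <;> rw [h] at h2 ⊢ <;>
      cases ha : χ (c i) <;> cases hb : χ (c (i + 1)) <;> simp_all

/-! ### Adding an edge to the graph -/

theorem adj_sup_edge {V : Type*} {G : SimpleGraph V} {u v a b : V}
    (h : (G ⊔ SimpleGraph.edge u v).Adj a b) :
    G.Adj a b ∨ a = u ∧ b = v ∨ a = v ∧ b = u := by
  rw [SimpleGraph.sup_adj, SimpleGraph.edge_adj] at h
  tauto

/-- If `u` and `v` are not joined by an even path in the neighbourhood of `h`, then this
neighbourhood has a 2-colouring that separates `u` and `v`. -/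
theorem exists_coloring_ne {V : Type*} {G : SimpleGraph V} (hG : LocallyBipartite G) {h u v : V}
    (hv : G.Adj h v)
    (hpath : ∀ c n, IsHubPath G h c n → c 0 = u → c n = v → n % 2 = 1) :
    ∃ χ : V → Bool, (∀ a b, G.Adj h a → G.Adj h b → G.Adj a b → χ a ≠ χ b) ∧ χ u ≠ χ v := by
  classical
  obtain ⟨χ, hχ⟩ := hG.exists_bool_coloring h
  by_cases hr : (hubGraph G h).Reachable u v
  · refine ⟨χ, hχ, ?_⟩
    obtain ⟨c, n, hp, h0, hn⟩ := exists_isHubPath hv hr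
    have := hp.color hχ
    rw [h0, hn, hpath c n hp h0 hn] at this
    rw [this]
    simp
  by_cases huv : χ u = χ v
  · refine ⟨fun a => χ a ^^ decide ((hubGraph G h).Reachable u a), ?_, ?_⟩
    · intro a b ha hb hab
      have hadj : (hubGraph G h).Adj a b := ⟨hab, ha, hb⟩
      have : (hubGraph G h).Reachable u a ↔ (hubGraph G h).Reachable u b :=
        ⟨fun h => h.trans hadj.reachable, fun h => h.trans hadj.symm.reachable⟩
      simp only [this]
      have := hχ a b ha hb hab
      simpa using this
    · simp [hr, huv]
  · exact ⟨χ, hχ, huv⟩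

/-- If no two vertices of `N(u) ∩ N(v)` are joined by an odd path in `N(u)`, then `N(u)` has a
2-colouring in which `N(u) ∩ N(v)` is monochromatic. -/
theorem exists_coloring_common {V : Type*} {G : SimpleGraph V} (hG : LocallyBipartite G) {u v : V}
    (hpath : ∀ c n, IsHubPath G u c n → G.Adj v (c 0) → G.Adj v (c n) → n % 2 = 0) :
    ∃ χ : V → Bool, (∀ a b, G.Adj u a → G.Adj u b → G.Adj a b → χ a ≠ χ b) ∧
      ∀ a, G.Adj u a → G.Adj v a → χ a = false := by
  classical
  obtain ⟨χ, hχ⟩ := hG.exists_bool_coloring u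
  refine ⟨fun a => χ a ^^ decide (∃ s, G.Adj u s ∧ G.Adj v s ∧ (hubGraph G u).Reachable s a ∧
    χ s = true), ?_, ?_⟩
  · intro a b ha hb hab
    have hadj : (hubGraph G u).Adj a b := ⟨hab, ha, hb⟩
    have : ∀ s, (hubGraph G u).Reachable s a ↔ (hubGraph G u).Reachable s b := fun s =>
      ⟨fun h => h.trans hadj.reachable, fun h => h.trans hadj.symm.reachable⟩
    simp only [this]
    have := hχ a b ha hb hab
    simpa using this
  · intro a ha hva
    have key : ∀ s, G.Adj u s → G.Adj v s → (hubGraph G u).Reachable s a → χ s = χ a := by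
      intro s _ hvs hr
      obtain ⟨c, n, hp, h0, hn⟩ := exists_isHubPath ha hr
      have := hp.color hχ
      rw [h0, hn, hpath c n hp (h0 ▸ hvs) (hn ▸ hva)] at this
      simpa using this.symm
    have hiff : (∃ s, G.Adj u s ∧ G.Adj v s ∧ (hubGraph G u).Reachable s a ∧ χ s = true) ↔
        χ a = true :=
      ⟨fun ⟨s, hus, hvs, hr, hs⟩ => key s hus hvs hr ▸ hs,
        fun h => ⟨a, ha, hva, SimpleGraph.Reachable.refl a, h⟩⟩
    simp only [hiff]
    simp

section

variable {V : Type*} [Fintype V] {G : SimpleGraph V}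

theorem not_isDense_of_not_chain (hd : LargeDegree G) {u v : V} (h : ¬ DenseChain G 2 u v) :
    ¬ IsDense G u v := fun hD => h (hd.chain_mono (by norm_num) hD.chain)

/-- For a pair `u, v` that is not dense, no two vertices of `N(u) ∩ N(v)` are joined by an odd path
in `N(u)`. -/
theorem IsHubPath.even_of_not_isDense (hd : LargeDegree G) (hG : LocallyBipartite G)
    (hk : NoClosedChain G 4) {u v : V} (huv : ¬ IsDense G u v) {c : ℕ → V} {n : ℕ}
    (hp : IsHubPath G u c n) (h0 : G.Adj v (c 0)) (hn : G.Adj v (c n)) : n % 2 = 0 := by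
  by_contra hodd
  have hle := hp.length_le hd hG (hd.noClosedChain_mono (by norm_num) hk)
  -- In the 4-cycle `u, c 0, v, c n` the diagonal `uv` is not dense, so the other one is. For `n = 2
  -- * m + 1 ≤ 7` this closes a chain of `m + 1 ≤ 4` dense pairs from `c n` to its neighbour `c (2 *
  -- m)`.
  have hD : IsDense G (c 0) (c n) :=
    (hd.isDense_or_isDense hG (hp.hub 0 (by omega)) h0.symm hn (hp.hub n le_rfl)).resolve_left huv
  obtain ⟨m, rfl⟩ : ∃ m, n = 2 * m + 1 := ⟨n / 2, by omega⟩
  exact hk _ _ (hd.chain_mono (by omega) (hD.symm.chain.trans (hp.chain m (by omega))))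
    (hp.adj (2 * m) (by omega)).symm

/-- Adding the edge `uv` keeps the graph locally bipartite. -/
theorem locallyBipartite_sup_edge (hd : LargeDegree G) (hG : LocallyBipartite G)
    (hk : NoClosedChain G 4) {u v : V} (huv : ¬ IsDense G u v)
    (hpath : ∀ h c n, IsHubPath G h c n → c 0 = u → c n = v → n % 2 = 1) :
    LocallyBipartite (G ⊔ SimpleGraph.edge u v) := by
  classical
  -- The neighbourhood of `u` gains `v`, whose neighbours there are the common neighbours of `u` and
  -- `v`; these can all be coloured `false`, which frees `true` for `v`.
  have endpoint : ∀ u v : V, ¬ IsDense G u v → ∃ χ : V → Bool, ∀ a b,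
      (G.Adj u a ∨ a = v) → (G.Adj u b ∨ b = v) → G.Adj a b → χ a ≠ χ b := by
    intro u v huv
    obtain ⟨χ, hχ, hS⟩ := exists_coloring_common (v := v) hG fun c n hp h0 hn =>
      hp.even_of_not_isDense hd hG hk huv h0 hn
    refine ⟨fun a => if a = v then true else χ a, ?_⟩
    intro a b ha hb hab
    by_cases hav : a = v
    · have hbv : b ≠ v := by rintro rfl; exact hab.ne hav
      simp [hav, hbv, hS b (hb.resolve_right hbv) (hav ▸ hab)]
    · by_cases hbv : b = v
      · simp [hav, hbv, hS a (ha.resolve_right hav) (hbv ▸ hab.symm)]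
      · simpa [hav, hbv] using hχ a b (ha.resolve_right hav) (hb.resolve_right hbv) hab
  refine locallyBipartite_of_bool_coloring fun w => ?_
  by_cases hwu : w = u
  · subst hwu
    obtain ⟨χ, hχ⟩ := endpoint w v huv
    have hn : ∀ a, (G ⊔ SimpleGraph.edge w v).Adj w a → G.Adj w a ∨ a = v := by
      intro a ha
      rcases adj_sup_edge ha with h | ⟨-, h⟩ | ⟨h1, h2⟩
      · exact Or.inl h
      · exact Or.inr h
      · exact absurd h2 ha.ne'
    refine ⟨χ, fun a b ha hb hab => hχ a b (hn a ha) (hn b hb) ?_⟩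
    rcases adj_sup_edge hab with h | ⟨h, -⟩ | ⟨-, h⟩
    · exact h
    · exact absurd h ha.ne'
    · exact absurd h hb.ne'
  by_cases hwv : w = v
  · subst hwv
    obtain ⟨χ, hχ⟩ := endpoint w u fun h => huv h.symm
    have hn : ∀ a, (G ⊔ SimpleGraph.edge u w).Adj w a → G.Adj w a ∨ a = u := by
      intro a ha
      rcases adj_sup_edge ha with h | ⟨-, h⟩ | ⟨h1, h2⟩
      · exact Or.inl h
      · exact absurd h ha.ne'
      · exact Or.inr h2
    refine ⟨χ, fun a b ha hb hab => hχ a b (hn a ha) (hn b hb) ?_⟩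
    rcases adj_sup_edge hab with h | ⟨-, h⟩ | ⟨h, -⟩
    · exact h
    · exact absurd h hb.ne'
    · exact absurd h ha.ne'
  have hn : ∀ a, (G ⊔ SimpleGraph.edge u v).Adj w a → G.Adj w a := by
    intro a ha
    rcases adj_sup_edge ha with h | ⟨h, -⟩ | ⟨h, -⟩
    · exact h
    · exact absurd h hwu
    · exact absurd h hwv
  by_cases hboth : G.Adj w u ∧ G.Adj w v
  · obtain ⟨χ, hχ, hne⟩ := exists_coloring_ne hG hboth.2 (hpath w)
    refine ⟨χ, fun a b ha hb hab => ?_⟩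
    rcases adj_sup_edge hab with h | ⟨rfl, rfl⟩ | ⟨rfl, rfl⟩
    · exact hχ a b (hn a ha) (hn b hb) h
    · exact hne
    · exact hne.symm
  · obtain ⟨χ, hχ⟩ := hG.exists_bool_coloring w
    refine ⟨χ, fun a b ha hb hab => ?_⟩
    rcases adj_sup_edge hab with h | ⟨rfl, rfl⟩ | ⟨rfl, rfl⟩
    · exact hχ a b (hn a ha) (hn b hb) h
    · exact absurd ⟨hn _ ha, hn _ hb⟩ hboth
    · exact absurd ⟨hn _ hb, hn _ ha⟩ hboth

/-- If all edges but `ij` of a Moser spindle are present, then the vertices in the places of `i` and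
`j` are joined by a chain of two dense pairs. -/
theorem denseChain_two_of_moserSpindle_deleteEdge (hd : LargeDegree G) (hG : LocallyBipartite G)
    (hk : NoClosedChain G 2) (f : Fin 7 → V) {i j : Fin 7}
    (hij : (i, j) ∈ ([(0, 1), (1, 2), (2, 3), (3, 4), (4, 5), (5, 6), (0, 6), (0, 5), (0, 2),
      (1, 3), (4, 6)] : List (Fin 7 × Fin 7)))
    (hadj : ∀ p ∈ ([(0, 1), (1, 2), (2, 3), (3, 4), (4, 5), (5, 6), (0, 6), (0, 5), (0, 2), (1, 3),
      (4, 6)] : List (Fin 7 × Fin 7)), p ≠ (i, j) → G.Adj (f p.1) (f p.2)) :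
    DenseChain G 2 (f i) (f j) := by
  -- For a missing inner edge `pq` of a diamond, one diagonal of the 4-cycle `a p b q` is dense. It
  -- is not `ab`, as `a, b, c` would be a closed 2-chain.
  have inner : ∀ a b c p q : V, G.Adj a p → G.Adj a q → G.Adj b p → G.Adj b q → IsDense G b c →
      G.Adj a c → DenseChain G 2 p q := by
    intro a b c p q hap haq hbp hbq hbc hac
    rcases hd.isDense_or_isDense hG hap hbp.symm hbq haq with h | h
    · exact absurd hac (hk _ _ ⟨b, h, hbc.chain⟩)
    · exact hd.chain_mono (by norm_num) h.chain
  have diamond : ∀ a b p q : V, G.Adj a p → G.Adj a q → G.Adj b p → G.Adj b q → G.Adj p q →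
      IsDense G a b := fun a b p q h1 h2 h3 h4 h5 => ⟨p, q, h5, h1, h2, h3, h4⟩
  simp only [List.forall_mem_cons, List.not_mem_nil, false_imp_iff, implies_true, and_true] at hadj
  simp only [List.mem_cons, List.not_mem_nil, or_false, Prod.mk.injEq] at hij
  obtain ⟨e01, e12, e23, e34, e45, e56, e06, e05, e02, e13, e46⟩ := hadj
  rcases hij with ⟨rfl, rfl⟩ | ⟨rfl, rfl⟩ | ⟨rfl, rfl⟩ | ⟨rfl, rfl⟩ | ⟨rfl, rfl⟩ | ⟨rfl, rfl⟩ |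
    ⟨rfl, rfl⟩ | ⟨rfl, rfl⟩ | ⟨rfl, rfl⟩ | ⟨rfl, rfl⟩ | ⟨rfl, rfl⟩
  · have DR := diamond _ _ _ _ (e05 (by decide)) (e06 (by decide)) (e45 (by decide))
      (e46 (by decide)) (e56 (by decide))
    exact (hd.denseChain_two_of_isDense_of_adj hG hk (e12 (by decide)) (e13 (by decide))
      (e23 (by decide)) (e02 (by decide)) (e34 (by decide)) DR.symm).symm
  · have DR := diamond _ _ _ _ (e05 (by decide)) (e06 (by decide)) (e45 (by decide))
      (e46 (by decide)) (e56 (by decide))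
    exact inner _ _ _ _ _ (e13 (by decide)).symm (e23 (by decide)).symm (e01 (by decide))
      (e02 (by decide)) DR (e34 (by decide))
  · have DR := diamond _ _ _ _ (e05 (by decide)) (e06 (by decide)) (e45 (by decide))
      (e46 (by decide)) (e56 (by decide))
    exact hd.denseChain_two_of_adj_of_isDense hG hk (e12 (by decide)).symm
      (e02 (by decide)).symm (e01 (by decide)).symm (e13 (by decide)).symm
      (e34 (by decide)) DR.symm
  · have DL := diamond _ _ _ _ (e01 (by decide)) (e02 (by decide)) (e13 (by decide)).symm
      (e23 (by decide)).symm (e12 (by decide))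
    have DR := diamond _ _ _ _ (e05 (by decide)) (e06 (by decide)) (e45 (by decide))
      (e46 (by decide)) (e56 (by decide))
    -- Without the edge joining their far ends, the two diamonds themselves are the chain.
    exact ⟨_, DL.symm, DR.chain⟩
  · have DL := diamond _ _ _ _ (e01 (by decide)) (e02 (by decide)) (e13 (by decide)).symm
      (e23 (by decide)).symm (e12 (by decide))
    exact (hd.denseChain_two_of_adj_of_isDense hG hk (e56 (by decide)) (e05 (by decide)).symm
      (e06 (by decide)).symm (e46 (by decide)) (e34 (by decide)).symm DL.symm).symm
  · have DL := diamond _ _ _ _ (e01 (by decide)) (e02 (by decide)) (e13 (by decide)).symm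
      (e23 (by decide)).symm (e12 (by decide))
    exact inner _ _ _ _ _ (e45 (by decide)) (e46 (by decide)) (e05 (by decide))
      (e06 (by decide)) DL (e34 (by decide)).symm
  · have DL := diamond _ _ _ _ (e01 (by decide)) (e02 (by decide)) (e13 (by decide)).symm
      (e23 (by decide)).symm (e12 (by decide))
    exact (hd.denseChain_two_of_isDense_of_adj hG hk (e56 (by decide)).symm
      (e46 (by decide)).symm (e45 (by decide)).symm (e05 (by decide))
      (e34 (by decide)).symm DL.symm).symm
  · have DL := diamond _ _ _ _ (e01 (by decide)) (e02 (by decide)) (e13 (by decide)).symm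
      (e23 (by decide)).symm (e12 (by decide))
    exact (hd.denseChain_two_of_isDense_of_adj hG hk (e56 (by decide)) (e45 (by decide)).symm
      (e46 (by decide)).symm (e06 (by decide)) (e34 (by decide)).symm DL.symm).symm
  · have DR := diamond _ _ _ _ (e05 (by decide)) (e06 (by decide)) (e45 (by decide))
      (e46 (by decide)) (e56 (by decide))
    exact (hd.denseChain_two_of_isDense_of_adj hG hk (e12 (by decide)).symm (e23 (by decide))
      (e13 (by decide)) (e01 (by decide)) (e34 (by decide)) DR.symm).symm
  · have DR := diamond _ _ _ _ (e05 (by decide)) (e06 (by decide)) (e45 (by decide))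
      (e46 (by decide)) (e56 (by decide))
    exact hd.denseChain_two_of_adj_of_isDense hG hk (e12 (by decide)) (e01 (by decide)).symm
      (e02 (by decide)).symm (e23 (by decide)).symm (e34 (by decide)) DR.symm
  · have DL := diamond _ _ _ _ (e01 (by decide)) (e02 (by decide)) (e13 (by decide)).symm
      (e23 (by decide)).symm (e12 (by decide))
    exact (hd.denseChain_two_of_adj_of_isDense hG hk (e56 (by decide)).symm
      (e06 (by decide)).symm (e05 (by decide)).symm (e45 (by decide))
      (e34 (by decide)).symm DL.symm).symm

/-- In a graph that is edge-maximal among the locally bipartite graphs without a Moser spindle,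
non-adjacent vertices are joined by a chain of two dense pairs or by an even path in some
neighbourhood. -/
theorem chain_or_isHubPath_of_not_adj (hd : LargeDegree G) (hk : NoClosedChain G 4)
    (hmax : Maximal (fun H : SimpleGraph V => LocallyBipartite H ∧ ¬ moserSpindle.IsContained H) G)
    {u v : V} (huv : u ≠ v) (hadj : ¬ G.Adj u v) :
    DenseChain G 2 u v ∨ ∃ h c m, IsHubPath G h c (2 * m) ∧ c 0 = u ∧ c (2 * m) = v := by
  by_contra hcon
  rw [not_or] at hcon
  obtain ⟨hchain, hpath⟩ := hcon
  have hG := hmax.prop.1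
  have hk2 := hd.noClosedChain_mono (by norm_num : 2 ≤ 4) hk
  have hG' : LocallyBipartite (G ⊔ SimpleGraph.edge u v) := by
    refine locallyBipartite_sup_edge hd hG hk (not_isDense_of_not_chain hd hchain) ?_
    intro h c n hp h0 hn
    by_contra hodd
    obtain ⟨m, rfl⟩ : ∃ m, n = 2 * m := ⟨n / 2, by omega⟩
    exact hpath ⟨h, c, m, hp, h0, hn⟩
  have hnew : (G ⊔ SimpleGraph.edge u v).Adj u v :=
    Or.inr ((SimpleGraph.edge_adj ..).2 ⟨Or.inl ⟨rfl, rfl⟩, huv⟩)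
  by_cases hM : moserSpindle.IsContained (G ⊔ SimpleGraph.edge u v)
  · obtain ⟨⟨f, hf⟩⟩ := hM
    have hf : Function.Injective f := hf
    have hall : ∀ p ∈ ([(0, 1), (1, 2), (2, 3), (3, 4), (4, 5), (5, 6), (0, 6), (0, 5), (0, 2),
        (1, 3), (4, 6)] : List (Fin 7 × Fin 7)), G.Adj (f p.1) (f p.2) ∨
          f p.1 = u ∧ f p.2 = v ∨ f p.1 = v ∧ f p.2 = u := by
      intro p hp
      apply adj_sup_edge
      apply f.map_rel
      revert p
      simp [moserSpindle]
    by_cases hex : ∃ p ∈ ([(0, 1), (1, 2), (2, 3), (3, 4), (4, 5), (5, 6), (0, 6), (0, 5), (0, 2),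
        (1, 3), (4, 6)] : List (Fin 7 × Fin 7)), ¬ G.Adj (f p.1) (f p.2)
    · obtain ⟨⟨i, j⟩, hp, hnot⟩ := hex
      have hij := (hall _ hp).resolve_left hnot
      have hD := denseChain_two_of_moserSpindle_deleteEdge hd hG hk2 f hp (by
        rintro ⟨k, l⟩ hq hne
        refine (hall _ hq).resolve_right fun h => ?_
        -- Listing every edge with its smaller end first shows that the injective `f` sends only one
        -- listed edge to `uv`, in either orientation.
        have hlt : ∀ p ∈ ([(0, 1), (1, 2), (2, 3), (3, 4), (4, 5), (5, 6), (0, 6), (0, 5), (0, 2),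
          (1, 3), (4, 6)] : List (Fin 7 × Fin 7)), p.1 < p.2 := by decide
        have h1 := hlt _ hp
        have h2 := hlt _ hq
        simp only at h h1 h2 hij
        rcases hij with ⟨a, b⟩ | ⟨a, b⟩ <;> rcases h with ⟨c, d⟩ | ⟨c, d⟩
        · exact hne (by rw [hf (c.trans a.symm), hf (d.trans b.symm)])
        · rw [hf (c.trans b.symm), hf (d.trans a.symm)] at h2
          exact lt_asymm h1 h2
        · rw [hf (c.trans b.symm), hf (d.trans a.symm)] at h2
          exact lt_asymm h1 h2
        · exact hne (by rw [hf (c.trans a.symm), hf (d.trans b.symm)]))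
      rcases hij with ⟨a, b⟩ | ⟨a, b⟩ <;> simp only at a b <;> rw [a, b] at hD
      · exact hchain hD
      · exact hchain hD.symm
    · push Not at hex
      exact hmax.prop.2 (moserSpindle_isContained f hf hex)
  · exact hadj (hmax.le_of_ge ⟨hG', hM⟩ le_sup_left hnew)

/-! ### Twins in edge-maximal graphs -/

/-- In the edge-maximal graphs, dense pairs have the same neighbours. -/
theorem IsDense.adj_of_adj (hd : LargeDegree G) (hk : NoClosedChain G 4)
    (hmax : Maximal (fun H : SimpleGraph V => LocallyBipartite H ∧ ¬ moserSpindle.IsContained H) G)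
    {u v w : V} (huv : IsDense G u v) (hwu : G.Adj w u) : G.Adj w v := by
  by_contra hwv
  have hne : w ≠ v := by
    rintro rfl
    exact hk _ _ (hd.chain_mono (by norm_num) huv.chain) hwu.symm
  rcases chain_or_isHubPath_of_not_adj hd hk hmax hne hwv with h | ⟨h, c, m, hp, rfl, rfl⟩
  · exact hk _ _ (hd.chain_mono (by norm_num) (h.trans huv.symm.chain)) hwu
  · have hle := hp.length_le hd hmax.prop.1 (hd.noClosedChain_mono (by norm_num) hk)
    -- For `m ≤ 3`, appending the dense pair gives a chain of at most four closed by the edge `wu`.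
    -- For `m = 4` it would have length five, so the nine-vertex path needs its own argument.
    rcases (show m ≤ 4 by omega).lt_or_eq with hm | rfl
    · exact hk _ _ (hd.chain_mono (by omega) ((hp.chain m le_rfl).trans huv.symm.chain)) hwu
    · exact hd.false_of_path_nine hmax.prop.1 hk (fun i hi => hp.hub i (by omega))
        (fun i hi => hp.adj i (by omega)) (fun i j x hij hj => hp.far i j x hij (by omega))
        hwu.symm huv

theorem DenseChain.adj_of_adj (hd : LargeDegree G) (hk : NoClosedChain G 4)
    (hmax : Maximal (fun H : SimpleGraph V => LocallyBipartite H ∧ ¬ moserSpindle.IsContained H) G)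
    {n : ℕ} {u v w : V} (huv : DenseChain G n u v) (hwu : G.Adj w u) : G.Adj w v := by
  induction n generalizing u with
  | zero => exact huv ▸ hwu
  | succ n ih =>
    obtain ⟨z, hz, hc⟩ := huv
    exact ih hc (hz.adj_of_adj hd hk hmax hwu)

/-- Non-adjacent vertices are equal or joined by a chain of dense pairs, along which neighbourhoods
are constant; so non-adjacency is transitive. -/
theorem isCompleteMultipartite_of_maximal (hd : LargeDegree G) (hk : NoClosedChain G 4)
    (hmax : Maximal (fun H : SimpleGraph V => LocallyBipartite H ∧ ¬ moserSpindle.IsContained H)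
      G) : G.IsCompleteMultipartite := by
  have twin : ∀ u v w, ¬ G.Adj u v → G.Adj w u → G.Adj w v := by
    intro u v w huv hwu
    by_cases hne : u = v
    · exact hne ▸ hwu
    rcases chain_or_isHubPath_of_not_adj hd hk hmax hne huv with h | ⟨h, c, m, hp, rfl, rfl⟩
    · exact h.adj_of_adj hd hk hmax hwu
    · exact (hp.chain m le_rfl).adj_of_adj hd hk hmax hwu
  exact ⟨fun u v w huv hvw huw => huv (twin w v u (fun h => hvw h.symm) huw)⟩

end

theorem theorem4 {V : Type*} [Fintype V] (G : SimpleGraph V) [DecidableRel G.Adj]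
    (hG : LocallyBipartite G)
    (hδ : (6 / 11 : ℝ) * (Fintype.card V : ℝ) < (G.minDegree : ℝ)) :
    G.Colorable 3 ∨ SimpleGraph.IsContained moserSpindle G := by
  classical
  rw [or_iff_not_imp_right]
  intro hM
  obtain ⟨H, hGH, hmax⟩ := Finite.exists_le_maximal
    (p := fun H : SimpleGraph V => LocallyBipartite H ∧ ¬ moserSpindle.IsContained H) ⟨hG, hM⟩
  have hd : LargeDegree H := by
    intro v
    have h1 : 6 * Fintype.card V < 11 * G.minDegree := by
      have : (6 * Fintype.card V : ℝ) < 11 * G.minDegree := by linarith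
      exact_mod_cast this
    have h2 := G.minDegree_le_degree v
    have h3 : G.degree v ≤ (Finset.univ.filter (H.Adj v)).card := by
      rw [← SimpleGraph.card_neighborFinset_eq_degree]
      refine Finset.card_le_card fun w hw => ?_
      rw [SimpleGraph.mem_neighborFinset] at hw
      simpa using hGH hw
    have h4 : 6 * Fintype.card V < 11 * (Finset.univ.filter (H.Adj v)).card := by omega
    convert h4
  have h2 := hmax.prop.1.noClosedChain_two hmax.prop.2
  have h4 := hd.noClosedChain_four hmax.prop.1 (hd.noClosedChain_three hmax.prop.1 h2)
  exact ((isCompleteMultipartite_of_maximal hd h4 hmax).colorable_of_cliqueFree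
    hmax.prop.1.cliqueFree_four).mono_left hGH
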